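/- Let $M$ be a spacetime: a smooth, Hausdorff, second countable manifold without boundary, with a smooth Lorentzian metric and a time orientation (any dimension). Let $I^+(p)$ (resp. $I^-(p)$) be the set of points that can be reached from $p$ by a future-directed (resp. past-directed) timelike curve, and put $I(p,q)=I^+(p)\cap I^-(q)$. Let $\prec$ (also written $K^+$) be the smallest relation on $M$ that is transitive, is closed as a subset of $M\times M$, and contains $\{(p,q): q\in I^+(p)\}$; put $K^+(p)=\{q : p\prec q\}$. Let $\partial K^+(p)$ be the set of all $x\in K^+(p)$ that are suprema with respect to $\prec$ of some increasing sequence $y_1\prec y_2\prec\cdots$ of points $y_i\notin K^+(p)$, and put $A^+(p)=K^+(p)\setminus\partial K^+(p)$. Define $K^-(p)$, $\partial K^-(p)$ and $A^-(p)$ in the same way, starting from $I^-$ instead of $I^+$, and put $A(p,q)=A^+(p)\cap A^-(q)$. Assume that $M$ is $K$-causal, that is, $p\prec q$ and $q\prec p$ imply $p=q$. Then: (i) for every $p\in M$, $A^+(p)$ is open in the manifold topology and equals the topological interior of $K^+(p)$; likewise $A^-(p)$ is open and equals the interior of $K^-(p)$; (ii) for all $p,q\in M$, $A(p,q)$ is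 open; (iii) every $x\in M$ has an open neighborhood $U$ such that, for all $p,q\in U$, $A^+(p)\cap U=I^+(p)\cap U$, $A^-(p)\cap U=I^-(p)\cap U$, and $A(p,q)=I(p,q)$. -/

import Mathlib

open Set Filter Topology
open scoped Manifold ContDiff Bundle

/-- A Lorentzian spacetime structure on a smooth `(n + 1)`-dimensional manifold `M` (without boundary):
a smooth metric tensor of signature `(-, +, …, +)` together with a time orientation, given by a
continuous timelike vector field. -/
structure Spacetime (n : ℕ) (M : Type*) [TopologicalSpace M]
    [ChartedSpace (EuclideanSpace ℝ (Fin (n + 1))) M] [IsManifold (𝓡 (n + 1)) ∞ M] where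
  /-- The metric tensor. -/
  metric : ∀ x : M, TangentSpace (𝓡 (n + 1)) x →L[ℝ] TangentSpace (𝓡 (n + 1)) x →L[ℝ] ℝ
  metric_symm : ∀ (x : M) (v w : TangentSpace (𝓡 (n + 1)) x), metric x v w = metric x w v
  /-- The metric is a smooth section of the bundle of bilinear forms. -/
  metric_contMDiff : ContMDiff (𝓡 (n + 1))
    ((𝓡 (n + 1)).prod 𝓘(ℝ, EuclideanSpace ℝ (Fin (n + 1)) →L[ℝ]
      EuclideanSpace ℝ (Fin (n + 1)) →L[ℝ] ℝ)) ∞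
    (fun x ↦ Bundle.TotalSpace.mk' (EuclideanSpace ℝ (Fin (n + 1)) →L[ℝ]
      EuclideanSpace ℝ (Fin (n + 1)) →L[ℝ] ℝ)
      (E := fun x : M ↦ TangentSpace (𝓡 (n + 1)) x →L[ℝ] TangentSpace (𝓡 (n + 1)) x →L[ℝ] ℝ)
      x (metric x))
  /-- The vector field that says which timelike vectors point to the future. -/
  orient : ∀ x : M, TangentSpace (𝓡 (n + 1)) x
  orient_continuous :
    Continuous (fun x ↦ (⟨x, orient x⟩ : TangentBundle (𝓡 (n + 1)) M))
  orient_timelike : ∀ x : M, metric x (orient x) (orient x) < 0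
  /-- The metric has signature `(-, +, …, +)`: the orthogonal complement of the timelike vector
  `orient x` is positive definite. -/
  metric_lorentzian : ∀ (x : M) (w : TangentSpace (𝓡 (n + 1)) x),
    metric x (orient x) w = 0 → w ≠ 0 → 0 < metric x w w

/-- The smallest topologically closed and transitive relation that contains `R`, obtained as the
intersection of all closed and transitive relations that contain `R`. -/
def closedTransHull {M : Type*} [TopologicalSpace M] (R : M → M → Prop) (p q : M) : Prop :=
  ∀ S : Set (M × M), IsClosed S → (∀ a b c, (a, b) ∈ S → (b, c) ∈ S → (a, c) ∈ S) →
    (∀ a b, R a b → (a, b) ∈ S) → (p, q) ∈ S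

/-- `x` is a supremum of the sequence `y` with respect to the relation `R`. -/
def IsSupSeq {M : Type*} (R : M → M → Prop) (y : ℕ → M) (x : M) : Prop :=
  (∀ i, R (y i) x) ∧ ∀ z, (∀ i, R (y i) z) → R x z

/-- The order-theoretic boundary of `{x | R p x}`: its elements that are suprema of an increasing
sequence of points of the complement. -/
def orderBoundary {M : Type*} (R : M → M → Prop) (p : M) : Set M :=
  {x | R p x ∧ ∃ y : ℕ → M, (∀ i, R (y i) (y (i + 1))) ∧ (∀ i, ¬ R p (y i)) ∧ IsSupSeq R y x}

namespace Spacetime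

variable {n : ℕ} {M : Type*} [TopologicalSpace M]
  [ChartedSpace (EuclideanSpace ℝ (Fin (n + 1))) M] [IsManifold (𝓡 (n + 1)) ∞ M]

/-- Future-directed timelike tangent vectors. -/
def FutureTimelike (S : Spacetime n M) {x : M} (v : TangentSpace (𝓡 (n + 1)) x) : Prop :=
  S.metric x v v < 0 ∧ S.metric x (S.orient x) v < 0

/-- There is a future-directed timelike `C¹` curve, parametrized by `[0, 1]`, from `p` to `q`. -/
def TimelikeSegment (S : Spacetime n M) (p q : M) : Prop :=
  ∃ γ : ℝ → M, ContMDiffOn 𝓘(ℝ, ℝ) (𝓡 (n + 1)) 1 γ (Icc 0 1) ∧ γ 0 = p ∧ γ 1 = q ∧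
    ∀ t ∈ Icc (0 : ℝ) 1,
      S.FutureTimelike (mfderivWithin 𝓘(ℝ, ℝ) (𝓡 (n + 1)) γ (Icc 0 1) t (1 : ℝ))

/-- The chronological relation: `q` can be reached from `p` by a future-directed timelike
(piecewise `C¹`) curve, that is, by a finite nonempty chain of `C¹` curves. -/
def Chron (S : Spacetime n M) : M → M → Prop :=
  Relation.TransGen S.TimelikeSegment

/-- The chronological future `I⁺(p)`. -/
def IPlus (S : Spacetime n M) (p : M) : Set M := {q | S.Chron p q}

/-- The chronological past `I⁻(p)`. -/
def IMinus (S : Spacetime n M) (p : M) : Set M := {q | S.Chron q p}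

/-- The chronological interval `I(p, q)`. -/
def IInterval (S : Spacetime n M) (p q : M) : Set M := S.IPlus p ∩ S.IMinus q

/-- The relation `K⁺`: the smallest closed and transitive relation that contains `I⁺`. -/
def KFut (S : Spacetime n M) : M → M → Prop :=
  closedTransHull fun p q ↦ q ∈ S.IPlus p

/-- The relation `K⁻`: the smallest closed and transitive relation that contains `I⁻`. -/
def KPast (S : Spacetime n M) : M → M → Prop :=
  closedTransHull fun p q ↦ q ∈ S.IMinus p

/-- The set `K⁺(p)`. -/
def KPlus (S : Spacetime n M) (p : M) : Set M := {q | S.KFut p q}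

/-- The set `K⁻(p)`. -/
def KMinus (S : Spacetime n M) (p : M) : Set M := {q | S.KPast p q}

/-- `K`-causality: the relation `K⁺` is antisymmetric. (It is always transitive, and it is
reflexive because every point is a limit of points of its chronological future.) -/
def KCausal (S : Spacetime n M) : Prop :=
  ∀ p q, S.KFut p q → S.KFut q p → p = q

/-- `A⁺(p)` is `K⁺(p)` without its order-theoretic boundary. -/
def APlus (S : Spacetime n M) (p : M) : Set M := S.KPlus p \ orderBoundary S.KFut p

/-- `A⁻(p)` is `K⁻(p)` without its order-theoretic boundary. (Suprema and increasing sequences for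
`K⁻` are infima and decreasing sequences for `K⁺`.) -/
def AMinus (S : Spacetime n M) (p : M) : Set M := S.KMinus p \ orderBoundary S.KPast p

/-- The open order-interval `A(p, q)`. -/
def AInterval (S : Spacetime n M) (p q : M) : Set M := S.APlus p ∩ S.AMinus q

end Spacetime

/-! The relation $K^+$ is handled through its minimality: a closed transitive relation that contains
$I^+$ contains $K^+$.

$A^+(p)$ is the interior of $K^+(p)$ for two reasons. A point $x\in K^+(p)$ outside the interior is
the limit of an increasing sequence in $I^-(x)$. A term in $K^+(p)$ would put its open future, a
neighborhood of $x$, inside $K^+(p)$; and the limit is a supremum because $K^+$ is closed.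
Conversely, K-causality makes increasing sequences converge to their suprema
(`KCausal.tendsto_of_isSupSeq`), so an interior point is no supremum of points outside. The
convergence rests on `KFut.exists_frontier`: if $p\prec q$ and an open set with compact frontier
separates them, some frontier point lies between them.

Locally, K-causality gives a $U$ whose order intervals lie in a small $W$. The pairs $a\prec b$ such
that every $r\in I^+(b)$ with $\{z: a\prec z\prec r\}\subseteq W$ lies in $I^+(a)$ form a closed
transitive relation, hence all of $K^+$ (`exists_nhds_chron_of_mem_interior`). An interior point of
$K^+(p)$ is in the future of some point of $K^+(p)$, hence in $I^+(p)$.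

Closedness there needs no limit curves. In a chart, timelike curves starting at $p'$ near $p$ become
timelike curves starting at $p$ after a translation plus a small tilt towards the future; the metric
is Lipschitz, so the tilt outweighs its variation (`exists_tilt_timelike`,
`exists_nhds_chron_of_frequently`). The statements about the past follow by time reversal. -/

/-! ### Linear algebra of timelike cones -/

section Cone

lemma ContinuousAt.eventually_norm_sub_le {X V : Type*} [TopologicalSpace X]
    [SeminormedAddCommGroup V] {f : X → V} {x : X} (h : ContinuousAt f x) {ε : ℝ} (hε : 0 < ε) :
    ∀ᶠ y in 𝓝 x, ‖f y - f x‖ ≤ ε :=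
  (tendsto_iff_norm_sub_tendsto_zero.1 h).eventually_le_const hε

variable {E : Type*} [NormedAddCommGroup E] [NormedSpace ℝ E]

/-- A Lorentzian form becomes positive definite after adding a multiple of the square of the dual of
a timelike vector. -/
lemma exists_pos_le_lorentz_add_sq [FiniteDimensional ℝ E] {g : E →L[ℝ] E →L[ℝ] ℝ} {e : E}
    (hsymm : ∀ v w, g v w = g w v) (he : g e e < 0)
    (hpos : ∀ w, g e w = 0 → w ≠ 0 → 0 < g w w) :
    ∃ m > 0, ∀ v, m * ‖v‖ ^ 2 ≤ g v v + 2 / (-g e e) * (g e v) ^ 2 := by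
  have key : ∀ v, v ≠ 0 → 0 < g v v + 2 / (-g e e) * (g e v) ^ 2 := by
    intro v hv
    set N := -g e e with hN
    have hN0 : 0 < N := by linarith
    have hee : g e e = -N := by rw [hN]; ring
    set a := -(g e v) / N with ha
    have hev : g e v = -(a * N) := by rw [ha]; field_simp
    have hw : g e (v - a • e) = 0 := by
      simp only [map_sub, map_smul, smul_eq_mul, hev, hee]; ring
    have hvv : g v v = g (v - a • e) (v - a • e) - a ^ 2 * N := by
      simp only [map_sub, map_smul, smul_eq_mul, _root_.sub_apply,
        _root_.smul_apply, hsymm v e, hev, hee]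
      ring
    rw [hvv, hev]
    -- For v = a e + w with w orthogonal to e, the form is g w w - a² N; the factor 2 / N adds 2 a²
    -- N and so turns -a² N into +a² N.
    have h2 : 2 / N * (-(a * N)) ^ 2 = 2 * a ^ 2 * N := by field_simp
    rw [h2]
    by_cases h0 : v - a • e = 0
    · have ha0 : a ≠ 0 := by
        rintro h
        rw [h, zero_smul, sub_zero] at h0
        exact hv h0
      rw [h0]
      simp only [map_zero]
      have : 0 < a ^ 2 * N := by positivity
      linarith
    · have := hpos _ hw h0
      have : 0 ≤ a ^ 2 * N := by positivity
      linarith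
  have he0 : e ≠ 0 := by
    rintro rfl
    simp at he
  have hne : (Metric.sphere (0 : E) 1).Nonempty := by
    refine ⟨‖e‖⁻¹ • e, ?_⟩
    simp [norm_smul, he0]
  have hcont : Continuous fun v ↦ g v v + 2 / (-g e e) * (g e v) ^ 2 := by fun_prop
  obtain ⟨u, hu, hmin⟩ := (isCompact_sphere (0 : E) 1).exists_isMinOn hne hcont.continuousOn
  have hu0 : u ≠ 0 := by
    rintro rfl
    simp at hu
  refine ⟨_, key u hu0, fun v ↦ ?_⟩
  by_cases hv : v = 0
  · simp [hv]
  have hv' : ‖v‖ ≠ 0 := by simpa using hv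
  have h1 : ‖v‖⁻¹ • v ∈ Metric.sphere (0 : E) 1 := by simp [norm_smul, hv]
  have h2 := hmin h1
  simp only [mem_ofPred_eq, map_smul, smul_eq_mul, _root_.smul_apply] at h2
  calc _ ≤ (‖v‖⁻¹ * (‖v‖⁻¹ * g v v) + 2 / (-g e e) * (‖v‖⁻¹ * g e v) ^ 2) * ‖v‖ ^ 2 := by gcongr
    _ = _ := by field_simp

lemma ContinuousLinearMap.abs_sub_apply₂_le (g g' : E →L[ℝ] E →L[ℝ] ℝ) (v w : E) :
    |g v w - g' v w| ≤ ‖g - g'‖ * ‖v‖ * ‖w‖ := by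
  simpa using (g - g').le_opNorm₂ v w

set_option synthInstance.maxHeartbeats 200000 in
/-- Near a point, the timelike cones of a continuous Lorentzian metric are uniformly separated from
the orthogonal complement of a fixed timelike vector. -/
lemma exists_uniform_cone [FiniteDimensional ℝ E] {G : E → E →L[ℝ] E →L[ℝ] ℝ} {F : E → E →L[ℝ] ℝ}
    {y₀ e : E} (hG : ContinuousAt G y₀) (hF : ContinuousAt F y₀)
    (hsymm : ∀ v w, G y₀ v w = G y₀ w v) (he : G y₀ e e < 0)
    (hpos : ∀ w, G y₀ e w = 0 → w ≠ 0 → 0 < G y₀ w w) (hFG : F y₀ = G y₀ e) :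
    ∃ κ > 0, ∀ᶠ y in 𝓝 y₀, G y e e < 0 ∧ ∀ v, G y v v < 0 →
      (F y v < 0 ↔ G y₀ e v < 0) ∧
      (G y₀ e v < 0 → κ * ‖v‖ ≤ -G y₀ e v ∧ G y v e ≤ -(κ * ‖v‖)) := by
  obtain ⟨m, hm, hbound⟩ := exists_pos_le_lorentz_add_sq hsymm he hpos
  set N := -G y₀ e e with hN
  have hN0 : 0 < N := by linarith
  -- If v is timelike at y, then G y₀ v v ≤ (m / 2) ‖v‖², so the bound with m forces |G y₀ e v| ≥ k
  -- ‖v‖. The perturbations below cost at most k / 2 of this, which leaves κ = k / 2.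
  set k := Real.sqrt (N * m / 4) with hk
  have hk0 : 0 < k := Real.sqrt_pos.2 (by positivity)
  have hk2 : k ^ 2 = N * m / 4 := Real.sq_sqrt (by positivity)
  have he0 : 0 < ‖e‖ := by
    rw [norm_pos_iff]
    rintro rfl
    simp at he
  refine ⟨k / 2, by positivity, ?_⟩
  have hee : ∀ᶠ y in 𝓝 y₀, G y e e < 0 := by
    have : ContinuousAt (fun y ↦ G y e e) y₀ := by fun_prop
    exact this.eventually_lt continuousAt_const he
  filter_upwards [hee, hG.eventually_norm_sub_le (V := E →L[ℝ] E →L[ℝ] ℝ) (show 0 < m / 2 by positivity),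
    hG.eventually_norm_sub_le (V := E →L[ℝ] E →L[ℝ] ℝ) (show 0 < k / 2 / ‖e‖ by positivity),
    hF.eventually_norm_sub_le (V := E →L[ℝ] ℝ) (show 0 < k / 2 by positivity)] with y hy1 hy2 hy3 hy4
  refine ⟨hy1, fun v hv ↦ ?_⟩
  have hv0 : 0 < ‖v‖ := by
    rw [norm_pos_iff]
    rintro rfl
    simp at hv
  have h1 := (abs_le.1 ((G y).abs_sub_apply₂_le (G y₀) v v)).1
  have h2 : ‖G y - G y₀‖ * ‖v‖ * ‖v‖ ≤ m / 2 * ‖v‖ * ‖v‖ := by gcongr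
  have h3 := hbound v
  have h4 : k * ‖v‖ ≤ |G y₀ e v| := by
    apply le_of_sq_le_sq _ (abs_nonneg _)
    rw [sq_abs, mul_pow, hk2]
    have : m / 2 * ‖v‖ ^ 2 ≤ 2 / N * (G y₀ e v) ^ 2 := by nlinarith
    calc N * m / 4 * ‖v‖ ^ 2 = N / 2 * (m / 2 * ‖v‖ ^ 2) := by ring
      _ ≤ N / 2 * (2 / N * (G y₀ e v) ^ 2) := by gcongr
      _ = _ := by field_simp
  have h5 : |F y v - G y₀ e v| ≤ k / 2 * ‖v‖ := by
    rw [← hFG]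
    refine (show |(F y - F y₀) v| ≤ _ from (F y - F y₀).le_opNorm v).trans ?_
    gcongr
  have h6 : |G y v e - G y₀ v e| ≤ k / 2 * ‖v‖ := by
    refine ((G y).abs_sub_apply₂_le (G y₀) v e).trans ?_
    calc ‖G y - G y₀‖ * ‖v‖ * ‖e‖ ≤ k / 2 / ‖e‖ * ‖v‖ * ‖e‖ := by gcongr
      _ = _ := by field_simp
  rw [hsymm v e] at h6
  rw [abs_le] at h5 h6
  have hkv : 0 < k * ‖v‖ := by positivity
  refine ⟨?_, fun hneg ↦ ?_⟩
  · rcases le_abs.1 h4 with h | h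
    · constructor <;> intro <;> linarith
    · constructor <;> intro <;> linarith
  · rw [abs_of_neg hneg] at h4
    constructor <;> linarith

set_option synthInstance.maxHeartbeats 200000 in
/-- For a Lipschitz Lorentzian metric, moving the base point of a timelike vector by `2 h` is
compensated by adding to it a multiple of `h` of a timelike vector. -/
lemma exists_tilt_timelike {G : E → E →L[ℝ] E →L[ℝ] ℝ} {s : Set E} {τ : E →L[ℝ] ℝ} {e : E}
    {L : NNReal} {κ : ℝ} (hκ : 0 < κ) (hL : LipschitzOnWith L G s)
    (hsymm : ∀ y ∈ s, ∀ v w, G y v w = G y w v) (hee : ∀ y ∈ s, G y e e < 0) (hτ : 0 < τ e)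
    (hcone : ∀ y ∈ s, ∀ v, G y v v < 0 → 0 < τ v → κ * ‖v‖ ≤ τ v ∧ G y v e ≤ -(κ * ‖v‖)) :
    ∃ C > 0, ∃ h₀ > 0, ∀ h, 0 ≤ h → h ≤ h₀ → ∀ y ∈ s, ∀ y' ∈ s, ‖y' - y‖ ≤ 2 * h →
      ∀ v, G y v v < 0 → 0 < τ v →
        G y' (v + (h * C * τ v) • e) (v + (h * C * τ v) • e) < 0 ∧
          0 < τ (v + (h * C * τ v) • e) := by
  -- With ‖v + a e‖ ≤ 2 ‖v‖, which h₀ guarantees, moving the base point costs at most 8 L h ‖v‖²,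
  -- while the tilt gains 2 a κ ‖v‖ ≥ (8 L + 2) h ‖v‖².
  set C := (4 * L + 1) / κ ^ 2 with hC
  have hC0 : 0 < C := by positivity
  refine ⟨C, hC0, 1 / (C * ‖τ‖ * ‖e‖ + 1), by positivity,
    fun h hh hh0 y hy y' hy' hyy v hv hτv ↦ ?_⟩
  obtain ⟨h1, h2⟩ := hcone y hy v hv hτv
  set a := h * C * τ v with ha
  have ha0 : 0 ≤ a := by positivity
  have hav : ‖a • e‖ ≤ ‖v‖ := by
    rw [norm_smul, Real.norm_of_nonneg ha0]
    have h3 : τ v ≤ ‖τ‖ * ‖v‖ := (le_abs_self _).trans (τ.le_opNorm v)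
    have h4 : h * (C * ‖τ‖ * ‖e‖) ≤ 1 := by
      rw [le_div_iff₀ (by positivity)] at hh0
      nlinarith
    calc a * ‖e‖ ≤ h * C * (‖τ‖ * ‖v‖) * ‖e‖ := by rw [ha]; gcongr
      _ = h * (C * ‖τ‖ * ‖e‖) * ‖v‖ := by ring
      _ ≤ 1 * ‖v‖ := by gcongr
      _ = _ := one_mul _
  set u := v + a • e with hu
  have hun : ‖u‖ ≤ 2 * ‖v‖ := (norm_add_le _ _).trans (by linarith)
  constructor
  · have h3 := (abs_le.1 ((G y').abs_sub_apply₂_le (G y) u u)).2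
    have h4 : ‖G y' - G y‖ ≤ L * (2 * h) := by
      have hd := hL.dist_le_mul y' hy' y hy
      rw [dist_eq_norm y' y] at hd
      rw [← dist_eq_norm (G y') (G y)]
      refine hd.trans ?_
      gcongr
    have h5 : ‖G y' - G y‖ * ‖u‖ * ‖u‖ ≤ L * (2 * h) * (2 * ‖v‖) * (2 * ‖v‖) := by gcongr
    have h6 : G y u u = G y v v + 2 * a * G y v e + a ^ 2 * G y e e := by
      simp only [hu, map_add, map_smul, _root_.add_apply,
        _root_.smul_apply, smul_eq_mul, hsymm y hy e v]
      ring
    have h7 : a ^ 2 * G y e e ≤ 0 := mul_nonpos_of_nonneg_of_nonpos (by positivity) (hee y hy).le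
    have h8 : a * G y v e ≤ -(h * (4 * L + 1) * ‖v‖ ^ 2) := by
      calc a * G y v e ≤ a * -(κ * ‖v‖) := by gcongr
        _ = -(h * C * τ v * (κ * ‖v‖)) := by rw [ha]; ring
        _ ≤ -(h * C * (κ * ‖v‖) * (κ * ‖v‖)) := by gcongr
        _ = _ := by rw [hC]; field_simp
    have h9 : 0 ≤ h * ‖v‖ ^ 2 := by positivity
    nlinarith
  · simp only [hu, map_add, map_smul, smul_eq_mul]
    positivity

end Cone

/-! ### Differentials of charts -/

section ChartFrame

variable {E : Type*} [NormedAddCommGroup E] [NormedSpace ℝ E]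
  {M : Type*} [TopologicalSpace M] [ChartedSpace E M]

/-- The derivative of the inverse of the preferred chart at `x`. -/
noncomputable def chartFrame (x : M) (y : E) :
    E →L[ℝ] TangentSpace 𝓘(ℝ, E) ((extChartAt 𝓘(ℝ, E) x).symm y) :=
  mfderiv 𝓘(ℝ, E) 𝓘(ℝ, E) (extChartAt 𝓘(ℝ, E) x).symm y

lemma contMDiff_const_vectorField (v : E) :
    ContMDiff 𝓘(ℝ, E) 𝓘(ℝ, E).tangent ∞ (fun y ↦ (⟨y, v⟩ : TangentBundle 𝓘(ℝ, E) E)) :=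
  contMDiff_vectorSpace_iff_contDiff.2 contDiff_const

variable [IsManifold 𝓘(ℝ, E) ∞ M]

lemma contMDiffOn_chartFrame (x : M) (v : E) :
    ContMDiffOn 𝓘(ℝ, E) 𝓘(ℝ, E).tangent ∞
      (fun y ↦ (⟨(extChartAt 𝓘(ℝ, E) x).symm y, chartFrame x y v⟩ : TangentBundle 𝓘(ℝ, E) M))
      (extChartAt 𝓘(ℝ, E) x).target := by
  have ho := isOpen_extChartAt_target (I := 𝓘(ℝ, E)) x
  have h1 := (contMDiffOn_extChartAt_symm (I := 𝓘(ℝ, E)) (n := ∞) x).contMDiffOn_tangentMapWithin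
    (m := ∞) (by simp) ho.uniqueMDiffOn
  refine (h1.comp (contMDiff_const_vectorField v).contMDiffOn (fun y hy ↦ hy)).congr fun y hy ↦ ?_
  simp only [Function.comp, tangentMapWithin, chartFrame, mfderivWithin_of_isOpen ho hy]
  rfl

lemma mfderivWithin_extChartAt_symm_comp (x : M) {c : ℝ → E} {t : ℝ}
    (hc : DifferentiableWithinAt ℝ c (Icc 0 1) t) (ht : t ∈ Icc (0 : ℝ) 1)
    (hct : c t ∈ (extChartAt 𝓘(ℝ, E) x).target) :
    mfderivWithin 𝓘(ℝ, ℝ) 𝓘(ℝ, E) ((extChartAt 𝓘(ℝ, E) x).symm ∘ c) (Icc 0 1) t (1 : ℝ) =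
      chartFrame x (c t) (derivWithin c (Icc 0 1) t) := by
  have hu : UniqueMDiffWithinAt 𝓘(ℝ, ℝ) (Icc (0 : ℝ) 1) t :=
    (uniqueDiffOn_Icc zero_lt_one t ht).uniqueMDiffWithinAt
  have h1 : MDifferentiableAt 𝓘(ℝ, E) 𝓘(ℝ, E) (extChartAt 𝓘(ℝ, E) x).symm (c t) :=
    (((contMDiffOn_extChartAt_symm (I := 𝓘(ℝ, E)) (n := ∞) x).contMDiffAt
      ((isOpen_extChartAt_target x).mem_nhds hct))).mdifferentiableAt (by simp)
  rw [mfderiv_comp_mfderivWithin t h1 hc.mdifferentiableWithinAt hu]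
  rw [mfderivWithin_eq_fderivWithin]
  rfl

lemma contDiffOn_chart_comp (x : M) {γ : ℝ → M} {s : Set ℝ}
    (hγ : ContMDiffOn 𝓘(ℝ, ℝ) 𝓘(ℝ, E) 1 γ s)
    (hmem : ∀ t ∈ s, γ t ∈ (extChartAt 𝓘(ℝ, E) x).source) :
    ContDiffOn ℝ 1 (extChartAt 𝓘(ℝ, E) x ∘ γ) s := by
  rw [← contMDiffOn_iff_contDiffOn]
  refine ((contMDiffOn_extChartAt (I := 𝓘(ℝ, E)) (n := ∞) (x := x)).of_le (by simp)).comp hγ ?_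
  intro t ht
  simpa using hmem t ht

end ChartFrame

/-! ### The metric and timelike curves in a chart -/

namespace Spacetime

variable {n : ℕ} {M : Type*} [TopologicalSpace M]
  [ChartedSpace (EuclideanSpace ℝ (Fin (n + 1))) M] [IsManifold (𝓡 (n + 1)) ∞ M]

variable (S : Spacetime n M)

/-- The metric tensor in the preferred chart at `x`. -/
noncomputable def chartMetric (x : M) (y : EuclideanSpace ℝ (Fin (n + 1))) :
    EuclideanSpace ℝ (Fin (n + 1)) →L[ℝ] EuclideanSpace ℝ (Fin (n + 1)) →L[ℝ] ℝ :=
  let g : EuclideanSpace ℝ (Fin (n + 1)) →L[ℝ] EuclideanSpace ℝ (Fin (n + 1)) →L[ℝ] ℝ :=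
    S.metric ((extChartAt (𝓡 (n + 1)) x).symm y)
  let A : EuclideanSpace ℝ (Fin (n + 1)) →L[ℝ] EuclideanSpace ℝ (Fin (n + 1)) := chartFrame x y
  g.bilinearComp A A

/-- The one-form dual to the time orientation in the preferred chart at `x`. -/
noncomputable def chartOrient (x : M) (y : EuclideanSpace ℝ (Fin (n + 1))) :
    EuclideanSpace ℝ (Fin (n + 1)) →L[ℝ] ℝ :=
  (S.metric ((extChartAt (𝓡 (n + 1)) x).symm y)
    (S.orient ((extChartAt (𝓡 (n + 1)) x).symm y))).comp (chartFrame x y)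

/-- It suffices to test on constant vectors, which the differential of the inverse chart carries to
smooth fields. This is where the Lipschitz constant of the metric comes from. -/
lemma contDiffOn_chartMetric (x : M) :
    ContDiffOn ℝ ∞ (S.chartMetric x) (extChartAt (𝓡 (n + 1)) x).target := by
  rw [contDiffOn_clm_apply]
  intro v
  rw [contDiffOn_clm_apply]
  intro w
  rw [← contMDiffOn_iff_contDiffOn]
  intro y hy
  have hb := contMDiffOn_extChartAt_symm (I := 𝓡 (n + 1)) (n := ∞) x y hy
  have : ContMDiffWithinAt 𝓘(ℝ, EuclideanSpace ℝ (Fin (n + 1))) ((𝓡 (n + 1)).prod 𝓘(ℝ)) ∞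
      (fun y ↦ Bundle.TotalSpace.mk' ℝ (E := Bundle.Trivial M ℝ)
        ((extChartAt (𝓡 (n + 1)) x).symm y) (S.metric ((extChartAt (𝓡 (n + 1)) x).symm y)
          (chartFrame x y v) (chartFrame x y w))) (extChartAt (𝓡 (n + 1)) x).target y := by
    apply ContMDiffWithinAt.clm_bundle_apply₂ (F₁ := EuclideanSpace ℝ (Fin (n + 1)))
      (F₂ := EuclideanSpace ℝ (Fin (n + 1)))
    · exact ContMDiffAt.comp_contMDiffWithinAt y S.metric_contMDiff.contMDiffAt hb
    · exact contMDiffOn_chartFrame x v y hy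
    · exact contMDiffOn_chartFrame x w y hy
  simp only [Bundle.contMDiffWithinAt_totalSpace] at this
  exact this.2

lemma continuousOn_chartOrient (x : M) :
    ContinuousOn (S.chartOrient x) (extChartAt (𝓡 (n + 1)) x).target := by
  rw [← contDiffOn_zero (𝕜 := ℝ), contDiffOn_clm_apply]
  intro w
  rw [← contMDiffOn_iff_contDiffOn]
  intro y hy
  have hb := (contMDiffOn_extChartAt_symm (I := 𝓡 (n + 1)) (n := ∞) x y hy).of_le
    (show (0 : WithTop ℕ∞) ≤ ∞ by simp)
  have : ContMDiffWithinAt 𝓘(ℝ, EuclideanSpace ℝ (Fin (n + 1))) ((𝓡 (n + 1)).prod 𝓘(ℝ)) 0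
      (fun y ↦ Bundle.TotalSpace.mk' ℝ (E := Bundle.Trivial M ℝ)
        ((extChartAt (𝓡 (n + 1)) x).symm y) (S.metric ((extChartAt (𝓡 (n + 1)) x).symm y)
          (S.orient ((extChartAt (𝓡 (n + 1)) x).symm y)) (chartFrame x y w)))
      (extChartAt (𝓡 (n + 1)) x).target y := by
    apply ContMDiffWithinAt.clm_bundle_apply₂ (F₁ := EuclideanSpace ℝ (Fin (n + 1)))
      (F₂ := EuclideanSpace ℝ (Fin (n + 1)))
    · exact ContMDiffAt.comp_contMDiffWithinAt y
        (S.metric_contMDiff.of_le (by simp)).contMDiffAt hb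
    · exact ContMDiffAt.comp_contMDiffWithinAt y
        (contMDiff_zero_iff.2 S.orient_continuous).contMDiffAt hb
    · exact (contMDiffOn_chartFrame x w y hy).of_le (by simp)
  simp only [Bundle.contMDiffWithinAt_totalSpace] at this
  exact this.2

lemma chartMetric_symm (x : M) (y v w : EuclideanSpace ℝ (Fin (n + 1))) :
    S.chartMetric x y v w = S.chartMetric x y w v :=
  S.metric_symm _ _ _

/-- Future-directed timelike vectors in the preferred chart at `x`. -/
def ChartTimelike (x : M) (y v : EuclideanSpace ℝ (Fin (n + 1))) : Prop :=
  S.chartMetric x y v v < 0 ∧ S.chartOrient x y v < 0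

lemma timelikeSegment_of_chart (x : M) {c : ℝ → EuclideanSpace ℝ (Fin (n + 1))}
    (hc : ContDiffOn ℝ 1 c (Icc 0 1))
    (hmem : ∀ t ∈ Icc (0 : ℝ) 1, c t ∈ (extChartAt (𝓡 (n + 1)) x).target)
    (ht : ∀ t ∈ Icc (0 : ℝ) 1, S.ChartTimelike x (c t) (derivWithin c (Icc 0 1) t)) :
    S.TimelikeSegment ((extChartAt (𝓡 (n + 1)) x).symm (c 0))
      ((extChartAt (𝓡 (n + 1)) x).symm (c 1)) := by
  refine ⟨(extChartAt (𝓡 (n + 1)) x).symm ∘ c, ?_, rfl, rfl, fun t h ↦ ?_⟩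
  · exact ((contMDiffOn_extChartAt_symm (I := 𝓡 (n + 1)) (n := ∞) x).of_le (by simp)).comp
      hc.contMDiffOn hmem
  · rw [mfderivWithin_extChartAt_symm_comp x (hc.differentiableOn (by simp) t h) h (hmem t h)]
    exact ht t h

lemma chartTimelike_chart_comp (x : M) {γ : ℝ → M}
    (hγ : ContMDiffOn 𝓘(ℝ, ℝ) (𝓡 (n + 1)) 1 γ (Icc 0 1))
    (hmem : ∀ t ∈ Icc (0 : ℝ) 1, γ t ∈ (extChartAt (𝓡 (n + 1)) x).source)
    (hfut : ∀ t ∈ Icc (0 : ℝ) 1,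
      S.FutureTimelike (mfderivWithin 𝓘(ℝ, ℝ) (𝓡 (n + 1)) γ (Icc 0 1) t (1 : ℝ)))
    {t : ℝ} (ht : t ∈ Icc (0 : ℝ) 1) :
    S.ChartTimelike x (extChartAt (𝓡 (n + 1)) x (γ t))
      (derivWithin (extChartAt (𝓡 (n + 1)) x ∘ γ) (Icc 0 1) t) := by
  have hc := contDiffOn_chart_comp x hγ hmem
  set c := extChartAt (𝓡 (n + 1)) x ∘ γ with hcdef
  have hEq : EqOn γ ((extChartAt (𝓡 (n + 1)) x).symm ∘ c) (Icc 0 1) := fun t ht ↦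
    ((extChartAt (𝓡 (n + 1)) x).left_inv (hmem t ht)).symm
  -- Passing from γ to its chart expression changes the base point of the tangent space, so the
  -- transfer is stated for arbitrary curves that agree on the interval.
  have key : ∀ (γ' : ℝ → M) (γ'' : ℝ → M), EqOn γ' γ'' (Icc 0 1) →
      S.FutureTimelike (mfderivWithin 𝓘(ℝ, ℝ) (𝓡 (n + 1)) γ' (Icc 0 1) t (1 : ℝ)) →
      S.FutureTimelike (mfderivWithin 𝓘(ℝ, ℝ) (𝓡 (n + 1)) γ'' (Icc 0 1) t (1 : ℝ)) := by
    intro γ' γ'' h hf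
    rw [mfderivWithin_congr h.symm (h ht).symm]
    simp only [FutureTimelike] at hf ⊢
    rw [← h ht]
    exact hf
  have := key _ _ hEq (hfut t ht)
  rw [mfderivWithin_extChartAt_symm_comp x (hc.differentiableOn (by simp) t ht) ht
    ((extChartAt (𝓡 (n + 1)) x).map_source (hmem t ht))] at this
  exact this

end Spacetime

/-! ### Affine reparametrization -/

section Charts

variable {E : Type*} [NormedAddCommGroup E] [NormedSpace ℝ E]
  {M : Type*} [TopologicalSpace M] [ChartedSpace E M]

lemma mfderivWithin_comp_affine {γ : ℝ → M} {a m t : ℝ}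
    (hγ : MDifferentiableWithinAt 𝓘(ℝ, ℝ) 𝓘(ℝ, E) γ (Icc 0 1) (a + m * t))
    (hσ : MapsTo (fun t ↦ a + m * t) (Icc 0 1) (Icc 0 1)) (ht : t ∈ Icc (0 : ℝ) 1) :
    mfderivWithin 𝓘(ℝ, ℝ) 𝓘(ℝ, E) (γ ∘ fun t ↦ a + m * t) (Icc 0 1) t (1 : ℝ) =
      m • (mfderivWithin 𝓘(ℝ, ℝ) 𝓘(ℝ, E) γ (Icc 0 1) (a + m * t) (1 : ℝ) :
        TangentSpace 𝓘(ℝ, E) (γ (a + m * t))) := by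
  have hu : UniqueDiffWithinAt ℝ (Icc (0 : ℝ) 1) t := uniqueDiffOn_Icc zero_lt_one t ht
  have hd : HasDerivAt (fun t ↦ a + m * t) m t := by
    simpa using ((hasDerivAt_id t).const_mul m).const_add a
  have hf : MDifferentiableWithinAt 𝓘(ℝ, ℝ) 𝓘(ℝ, ℝ) (fun t ↦ a + m * t) (Icc 0 1) t :=
    hd.differentiableAt.differentiableWithinAt.mdifferentiableWithinAt
  rw [mfderivWithin_comp (u := Icc (0 : ℝ) 1) t hγ hf (fun _ h ↦ hσ h) hu.uniqueMDiffWithinAt, mfderivWithin_eq_fderivWithin]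
  have h1 : fderivWithin ℝ (fun t ↦ a + m * t) (Icc 0 1) t (1 : ℝ) = m • (1 : ℝ) := by
    have := hd.hasDerivWithinAt.derivWithin hu
    rw [derivWithin] at this
    rw [this]
    simp
  change mfderivWithin 𝓘(ℝ, ℝ) 𝓘(ℝ, E) γ (Icc 0 1) (a + m * t)
    (fderivWithin ℝ (fun t ↦ a + m * t) (Icc 0 1) t (1 : ℝ)) = _
  rw [h1]
  exact map_smul (mfderivWithin 𝓘(ℝ, ℝ) 𝓘(ℝ, E) γ (Icc 0 1) (a + m * t)) m (1 : ℝ)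

lemma contMDiffOn_comp_affine {γ : ℝ → M} (hγ : ContMDiffOn 𝓘(ℝ, ℝ) 𝓘(ℝ, E) 1 γ (Icc 0 1))
    {a m : ℝ} (hσ : MapsTo (fun t ↦ a + m * t) (Icc (0 : ℝ) 1) (Icc (0 : ℝ) 1)) :
    ContMDiffOn 𝓘(ℝ, ℝ) 𝓘(ℝ, E) 1 (γ ∘ fun t ↦ a + m * t) (Icc 0 1) := by
  refine hγ.comp (ContDiff.contMDiff ?_).contMDiffOn hσ
  fun_prop

lemma extChartAt_symm_tendsto (x : M) {y : M} (hy : y ∈ (extChartAt 𝓘(ℝ, E) x).source) :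
    Tendsto (extChartAt 𝓘(ℝ, E) x).symm (𝓝 (extChartAt 𝓘(ℝ, E) x y)) (𝓝 y) := by
  have := continuousAt_extChartAt_symm' (I := 𝓘(ℝ, E)) hy
  rw [ContinuousAt, (extChartAt 𝓘(ℝ, E) x).left_inv hy] at this
  exact this

end Charts

/-! ### Time reversal and openness of chronological futures and pasts -/

namespace Spacetime

variable {n : ℕ} {M : Type*} [TopologicalSpace M]
  [ChartedSpace (EuclideanSpace ℝ (Fin (n + 1))) M] [IsManifold (𝓡 (n + 1)) ∞ M]
  (S : Spacetime n M)

/-- Future-directed timelike `C¹` curves, parametrized by `[0, 1]`. -/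
def IsTimelikeCurve (γ : ℝ → M) : Prop :=
  ContMDiffOn 𝓘(ℝ, ℝ) (𝓡 (n + 1)) 1 γ (Icc 0 1) ∧ ∀ t ∈ Icc (0 : ℝ) 1,
    S.FutureTimelike (mfderivWithin 𝓘(ℝ, ℝ) (𝓡 (n + 1)) γ (Icc 0 1) t (1 : ℝ))

/-- The time-reversed spacetime. -/
noncomputable def rev : Spacetime n M where
  metric := S.metric
  metric_symm := S.metric_symm
  metric_contMDiff := S.metric_contMDiff
  orient x := -S.orient x
  orient_continuous := by
    rw [← contMDiff_zero_iff (𝕜 := ℝ) (I := 𝓡 (n + 1)) (I' := (𝓡 (n + 1)).tangent)]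
    exact ContMDiff.neg_section (contMDiff_zero_iff.2 S.orient_continuous)
  orient_timelike x := by simpa using S.orient_timelike x
  metric_lorentzian x w h := S.metric_lorentzian x w (by simpa using h)

variable {S}

lemma FutureTimelike.smul {x : M} {v : TangentSpace (𝓡 (n + 1)) x} (hv : S.FutureTimelike v)
    {m : ℝ} (hm : 0 < m) : S.FutureTimelike (m • v) := by
  obtain ⟨h1, h2⟩ := hv
  refine ⟨?_, ?_⟩
  · simp only [map_smul, _root_.smul_apply, smul_eq_mul]
    exact mul_neg_of_pos_of_neg hm (mul_neg_of_pos_of_neg hm h1)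
  · simp only [map_smul, smul_eq_mul]
    exact mul_neg_of_pos_of_neg hm h2

lemma FutureTimelike.rev_smul {x : M} {v : TangentSpace (𝓡 (n + 1)) x} (hv : S.FutureTimelike v) :
    S.rev.FutureTimelike ((-1 : ℝ) • v) := by
  obtain ⟨h1, h2⟩ := hv
  simp only [FutureTimelike, rev, neg_smul, one_smul, map_neg, _root_.neg_apply, neg_neg]
  exact ⟨h1, h2⟩

lemma IsTimelikeCurve.timelikeSegment {γ : ℝ → M} (hγ : S.IsTimelikeCurve γ) :
    S.TimelikeSegment (γ 0) (γ 1) :=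
  ⟨γ, hγ.1, rfl, rfl, hγ.2⟩

lemma IsTimelikeCurve.comp_affine {γ : ℝ → M} (hγ : S.IsTimelikeCurve γ) {a m : ℝ} (hm : 0 < m)
    (hσ : MapsTo (fun t ↦ a + m * t) (Icc (0 : ℝ) 1) (Icc (0 : ℝ) 1)) :
    S.IsTimelikeCurve (γ ∘ fun t ↦ a + m * t) := by
  refine ⟨contMDiffOn_comp_affine hγ.1 hσ, fun t ht ↦ ?_⟩
  rw [mfderivWithin_comp_affine ((hγ.1.mdifferentiableOn (by simp)) _ (hσ ht)) hσ ht]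
  exact (hγ.2 _ (hσ ht)).smul hm

lemma IsTimelikeCurve.rev {γ : ℝ → M} (hγ : S.IsTimelikeCurve γ) :
    S.rev.IsTimelikeCurve (γ ∘ fun t ↦ 1 + (-1) * t) := by
  have hσ : MapsTo (fun t ↦ 1 + (-1) * t) (Icc (0 : ℝ) 1) (Icc (0 : ℝ) 1) := by
    rintro t ⟨h0, h1⟩
    constructor <;> simp only <;> linarith
  refine ⟨contMDiffOn_comp_affine hγ.1 hσ, fun t ht ↦ ?_⟩
  rw [mfderivWithin_comp_affine ((hγ.1.mdifferentiableOn (by simp)) _ (hσ ht)) hσ ht]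
  exact (hγ.2 _ (hσ ht)).rev_smul

lemma rev_rev : S.rev.rev = S := by
  cases S
  simp [rev]

lemma TimelikeSegment.rev {p q : M} (h : S.TimelikeSegment p q) : S.rev.TimelikeSegment q p := by
  obtain ⟨γ, h1, rfl, rfl, h2⟩ := h
  simpa using (IsTimelikeCurve.rev ⟨h1, h2⟩).timelikeSegment

lemma rev_timelikeSegment {p q : M} : S.rev.TimelikeSegment p q ↔ S.TimelikeSegment q p :=
  ⟨fun h ↦ by simpa [rev_rev] using h.rev, fun h ↦ h.rev⟩

lemma rev_chron {p q : M} : S.rev.Chron p q ↔ S.Chron q p := by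
  have : S.rev.TimelikeSegment = Function.swap S.TimelikeSegment := by
    ext p q
    exact rev_timelikeSegment
  rw [Chron, this, Relation.transGen_swap]
  rfl

lemma rev_IPlus (p : M) : S.rev.IPlus p = S.IMinus p := by
  ext q
  exact rev_chron

lemma IsTimelikeCurve.timelikeSegment_of_lt {γ : ℝ → M} (hγ : S.IsTimelikeCurve γ) {a b : ℝ}
    (ha : 0 ≤ a) (hab : a < b) (hb : b ≤ 1) : S.TimelikeSegment (γ a) (γ b) := by
  have hσ : MapsTo (fun t ↦ a + (b - a) * t) (Icc (0 : ℝ) 1) (Icc (0 : ℝ) 1) := by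
    rintro t ⟨h0, h1⟩
    constructor <;> simp only <;> nlinarith
  simpa using (hγ.comp_affine (sub_pos.2 hab) hσ).timelikeSegment

lemma ChartTimelike.smul {x : M} {y v : EuclideanSpace ℝ (Fin (n + 1))}
    (hv : S.ChartTimelike x y v) {m : ℝ} (hm : 0 < m) : S.ChartTimelike x y (m • v) := by
  obtain ⟨h1, h2⟩ := hv
  refine ⟨?_, ?_⟩
  · simp only [map_smul, _root_.smul_apply, smul_eq_mul]
    exact mul_neg_of_pos_of_neg hm (mul_neg_of_pos_of_neg hm h1)
  · simp only [map_smul, smul_eq_mul]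
    exact mul_neg_of_pos_of_neg hm h2

lemma ChartTimelike.eventually {x : M} {y v : EuclideanSpace ℝ (Fin (n + 1))}
    (hv : S.ChartTimelike x y v) (hy : y ∈ (extChartAt (𝓡 (n + 1)) x).target) :
    ∃ ε > 0, Metric.ball y ε ⊆ (extChartAt (𝓡 (n + 1)) x).target ∧
      ∀ z ∈ Metric.ball y ε, ∀ w ∈ Metric.ball v ε, S.ChartTimelike x z w := by
  have ho := (isOpen_extChartAt_target (I := 𝓡 (n + 1)) x).mem_nhds hy
  have hG : ContinuousAt (S.chartMetric x) y :=
    (S.contDiffOn_chartMetric x).continuousOn.continuousAt ho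
  have hF : ContinuousAt (S.chartOrient x) y := (S.continuousOn_chartOrient x).continuousAt ho
  have h1 : ContinuousAt (fun p : EuclideanSpace ℝ (Fin (n + 1)) × EuclideanSpace ℝ (Fin (n + 1)) ↦
      S.chartMetric x p.1 p.2 p.2) (y, v) := by
    have := hG.comp (x := (y, v)) (f := Prod.fst) continuousAt_fst
    exact (this.clm_apply continuousAt_snd).clm_apply continuousAt_snd
  have h2 : ContinuousAt (fun p : EuclideanSpace ℝ (Fin (n + 1)) × EuclideanSpace ℝ (Fin (n + 1)) ↦
      S.chartOrient x p.1 p.2) (y, v) := by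
    have := hF.comp (x := (y, v)) (f := Prod.fst) continuousAt_fst
    exact this.clm_apply continuousAt_snd
  have h3 := (h1.eventually_lt continuousAt_const hv.1).and
    (h2.eventually_lt continuousAt_const hv.2)
  obtain ⟨ε, hε, hball⟩ := Metric.eventually_nhds_iff_ball.1 h3
  obtain ⟨ε', hε', hball'⟩ := Metric.mem_nhds_iff.1 ho
  refine ⟨min ε ε', lt_min hε hε', fun z hz ↦ hball' (Metric.ball_subset_ball (min_le_right _ _) hz),
    fun z hz w hw ↦ hball (z, w) ?_⟩
  rw [← ball_prod_same]
  exact ⟨Metric.ball_subset_ball (min_le_left _ _) hz, Metric.ball_subset_ball (min_le_left _ _) hw⟩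

/-- A straight line in a chart whose direction is timelike along the line is a timelike segment. -/
lemma timelikeSegment_of_line (x : M) {a b : EuclideanSpace ℝ (Fin (n + 1))}
    {B : Set (EuclideanSpace ℝ (Fin (n + 1)))} (hB : Convex ℝ B)
    (hBt : B ⊆ (extChartAt (𝓡 (n + 1)) x).target) (ha : a ∈ B) (hb : b ∈ B)
    (ht : ∀ z ∈ B, S.ChartTimelike x z (b - a)) :
    S.TimelikeSegment ((extChartAt (𝓡 (n + 1)) x).symm a)
      ((extChartAt (𝓡 (n + 1)) x).symm b) := by
  set c : ℝ → EuclideanSpace ℝ (Fin (n + 1)) := fun t ↦ a + t • (b - a) with hc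
  have hmem : ∀ t ∈ Icc (0 : ℝ) 1, c t ∈ B := fun t ht ↦ hB.add_smul_sub_mem ha hb ht
  have hd : ∀ t, HasDerivAt c (b - a) t := fun t ↦ by
    have := ((hasDerivAt_id t).smul_const (b - a)).const_add a
    rwa [one_smul] at this
  have hcd : ContDiff ℝ 1 c := by fun_prop
  have := timelikeSegment_of_chart S x (c := c) hcd.contDiffOn (fun t h ↦ hBt (hmem t h))
    fun t h ↦ by
      rw [(hd t).hasDerivWithinAt.derivWithin (uniqueDiffOn_Icc zero_lt_one t h)]
      exact ht _ (hmem t h)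
  simpa [hc] using this

/-- Difference quotients at the endpoint tend to the timelike velocity there, so in the chart a
short final chord is timelike. This is an open condition on the endpoint of the chord, which may
therefore be moved. -/
lemma IsTimelikeCurve.eventually_chron {γ : ℝ → M} (hγ : S.IsTimelikeCurve γ)
    (hmem : ∀ t ∈ Icc (0 : ℝ) 1, γ t ∈ (extChartAt (𝓡 (n + 1)) (γ 1)).source) :
    ∀ᶠ q in 𝓝 (γ 1), S.Chron (γ 0) q := by
  have h1 : (1 : ℝ) ∈ Icc (0 : ℝ) 1 := by simp
  set x := γ 1 with hx
  set c := extChartAt (𝓡 (n + 1)) x ∘ γ with hc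
  have hcd : ContDiffOn ℝ 1 c (Icc 0 1) := contDiffOn_chart_comp x hγ.1 hmem
  have hv := S.chartTimelike_chart_comp x hγ.1 hmem hγ.2 h1
  obtain ⟨ε, hε, hBt, hB⟩ := hv.eventually ((extChartAt (𝓡 (n + 1)) x).map_source (hmem 1 h1))
  have hder := (hcd.differentiableOn (by simp) 1 h1).hasDerivWithinAt
  have hslope := hasDerivWithinAt_iff_tendsto_slope.1 hder
  have hset : Icc (0 : ℝ) 1 \ {1} = Ico 0 1 := by simp
  rw [hset] at hslope
  have hcont : Tendsto c (𝓝[Ico 0 1] 1) (𝓝 (c 1)) :=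
    (hcd.continuousOn 1 h1).mono_left (nhdsWithin_mono _ Ico_subset_Icc_self)
  have : (𝓝[Ico (0 : ℝ) 1] 1).NeBot := by
    rw [nhdsWithin_Ico_eq_nhdsLT zero_lt_one]
    infer_instance
  have hpos : ∀ᶠ t : ℝ in 𝓝[Ico 0 1] 1, 0 < t :=
    nhdsWithin_le_nhds (eventually_gt_nhds zero_lt_one)
  obtain ⟨t, ht, ht0, htc, hts⟩ := ((eventually_mem_nhdsWithin (s := Ico (0 : ℝ) 1) (a := 1)).and
    (hpos.and ((hcont.eventually (Metric.ball_mem_nhds _ hε)).and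
    (hslope.eventually (Metric.ball_mem_nhds _ hε))))).exists
  have ht1 : 0 < 1 - t := sub_pos.2 ht.2
  have hslopeq : slope c 1 t = (1 - t)⁻¹ • (c 1 - c t) := by
    rw [slope_comm, slope_def_module]
  rw [hslopeq] at hts
  have hcz : ContinuousAt (fun z ↦ (1 - t)⁻¹ • (z - c t)) (c 1) := by fun_prop
  have hnear : ∀ᶠ z in 𝓝 (c 1), S.Chron (γ 0) ((extChartAt (𝓡 (n + 1)) x).symm z) := by
    filter_upwards [hcz.eventually (Metric.isOpen_ball.mem_nhds hts),
      Metric.ball_mem_nhds (c 1) hε] with z hz hzb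
    have hseg : S.TimelikeSegment ((extChartAt (𝓡 (n + 1)) x).symm (c t))
        ((extChartAt (𝓡 (n + 1)) x).symm z) := by
      refine timelikeSegment_of_line x (convex_ball (c 1) ε) hBt htc hzb fun w hw ↦ ?_
      have := (hB w hw _ hz).smul ht1
      rwa [smul_inv_smul₀ ht1.ne'] at this
    rw [hc, Function.comp, (extChartAt (𝓡 (n + 1)) x).left_inv (hmem t ⟨ht.1, ht.2.le⟩)] at hseg
    exact .tail (.single (hγ.timelikeSegment_of_lt le_rfl ht0 ht.2.le)) hseg
  have hxs : x ∈ (extChartAt (𝓡 (n + 1)) x).source := mem_extChartAt_source x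
  filter_upwards [(continuousAt_extChartAt (I := 𝓡 (n + 1)) x).eventually hnear,
    extChartAt_source_mem_nhds (I := 𝓡 (n + 1)) x] with q hq hqs
  rwa [(extChartAt (𝓡 (n + 1)) x).left_inv hqs] at hq

lemma TimelikeSegment.eventually_chron {p q : M} (h : S.TimelikeSegment p q) :
    ∀ᶠ r in 𝓝 q, S.Chron p r := by
  obtain ⟨γ, h1, rfl, rfl, h2⟩ := h
  have hγ : S.IsTimelikeCurve γ := ⟨h1, h2⟩
  have hcont : Tendsto γ (𝓝[Icc 0 1] 1) (𝓝 (γ 1)) := h1.continuousOn 1 (by simp)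
  have hev := hcont.eventually (extChartAt_source_mem_nhds (I := 𝓡 (n + 1)) (γ 1))
  obtain ⟨δ, hδ, hball⟩ := Metric.mem_nhdsWithin_iff.1 hev
  -- The piece over [1 - m, 1] lies in the chart domain at the endpoint, and m < 1 leaves a
  -- nontrivial initial piece to prepend.
  set m := min (δ / 2) (1 / 2) with hm
  have hm0 : 0 < m := by positivity
  have hm1 : m ≤ 1 / 2 := min_le_right _ _
  have hmδ : m ≤ δ / 2 := min_le_left _ _
  have hσ : MapsTo (fun t ↦ (1 - m) + m * t) (Icc (0 : ℝ) 1) (Icc (0 : ℝ) 1) := by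
    rintro t ⟨h0, h1⟩
    constructor <;> simp only <;> nlinarith
  have hev := (hγ.comp_affine hm0 hσ).eventually_chron (fun t ht ↦ by
    simp only [Function.comp, mul_one, sub_add_cancel]
    refine hball ⟨?_, hσ ht⟩
    rw [Metric.mem_ball, Real.dist_eq, abs_lt]
    constructor <;> nlinarith [ht.1, ht.2])
  simp only [Function.comp, mul_one, sub_add_cancel, mul_zero, add_zero] at hev
  filter_upwards [hev] with r hr
  exact .head (hγ.timelikeSegment_of_lt le_rfl (by linarith) (by linarith)) hr

variable (S) in
lemma isOpen_IPlus (p : M) : IsOpen (S.IPlus p) := by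
  rw [isOpen_iff_eventually]
  intro q hq
  rcases Relation.TransGen.tail'_iff.1 hq with ⟨b, hpb, hbq⟩
  filter_upwards [hbq.eventually_chron] with r hr
  exact Relation.TransGen.trans_right hpb hr

variable (S) in
lemma isOpen_IMinus (p : M) : IsOpen (S.IMinus p) := by
  rw [← rev_IPlus]
  exact S.rev.isOpen_IPlus p

end Spacetime

/-! ### Local cone estimates and limits of chronological pairs -/

namespace Spacetime

variable {n : ℕ} {M : Type*} [TopologicalSpace M]
  [ChartedSpace (EuclideanSpace ℝ (Fin (n + 1))) M] [IsManifold (𝓡 (n + 1)) ∞ M]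
  (S : Spacetime n M)

lemma chartFrame_bijective (x : M) {y : EuclideanSpace ℝ (Fin (n + 1))}
    (hy : y ∈ (extChartAt (𝓡 (n + 1)) x).target) : Function.Bijective (chartFrame x y) := by
  have h : IsManifold (𝓡 (n + 1)) 1 M := IsManifold.of_le (n := ∞) (by simp)
  have := isInvertible_mfderivWithin_extChartAt_symm (I := 𝓡 (n + 1)) hy
  rw [ModelWithCorners.range_eq_univ, mfderivWithin_univ] at this
  exact this.bijective

lemma exists_chartFrame_eq_orient (x : M) :
    ∃ e, chartFrame x (extChartAt (𝓡 (n + 1)) x x) e =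
      S.orient ((extChartAt (𝓡 (n + 1)) x).symm (extChartAt (𝓡 (n + 1)) x x)) :=
  (chartFrame_bijective x (mem_extChartAt_target x)).2 _

/-- Every point is the limit of an increasing sequence in its chronological past. -/
lemma exists_seq_chron_tendsto (x : M) :
    ∃ y : ℕ → M, Tendsto y atTop (𝓝 x) ∧ (∀ i, S.Chron (y i) (y (i + 1))) ∧
      ∀ i, S.Chron (y i) x := by
  obtain ⟨e, he⟩ := S.exists_chartFrame_eq_orient x
  set y₀ := extChartAt (𝓡 (n + 1)) x x with hy₀
  have het : S.ChartTimelike x y₀ e := by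
    constructor
    · change S.metric _ (chartFrame x y₀ e) (chartFrame x y₀ e) < 0
      rw [he]
      exact S.orient_timelike _
    · change S.metric _ _ (chartFrame x y₀ e) < 0
      rw [he]
      exact S.orient_timelike _
  obtain ⟨ε, hε, hBt, hB⟩ := het.eventually (mem_extChartAt_target x)
  -- The sequence runs along the line y₀ - s e at s = k / (i + 1); this k keeps it inside the ball
  -- where e is timelike.
  set k := ε / (2 * (‖e‖ + 1)) with hk
  have hk0 : 0 < k := by positivity
  have hmem : ∀ s, 0 ≤ s → s ≤ k → y₀ - s • e ∈ Metric.ball y₀ ε := by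
    intro s hs hsk
    rw [Metric.mem_ball, dist_eq_norm, sub_sub_cancel_left, norm_neg, norm_smul,
      Real.norm_of_nonneg hs]
    calc s * ‖e‖ ≤ k * (‖e‖ + 1) := by gcongr; linarith
      _ = ε / 2 := by rw [hk]; field_simp
      _ < ε := by linarith
  have hseg : ∀ s s', 0 ≤ s → s < s' → s' ≤ k → S.TimelikeSegment
      ((extChartAt (𝓡 (n + 1)) x).symm (y₀ - s' • e))
      ((extChartAt (𝓡 (n + 1)) x).symm (y₀ - s • e)) := by
    intro s s' hs hss hsk
    refine timelikeSegment_of_line x (convex_ball y₀ ε) hBt (hmem _ (by linarith) hsk)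
      (hmem _ hs (by linarith)) fun w hw ↦ ?_
    have := (hB w hw e (Metric.mem_ball_self hε)).smul (sub_pos.2 hss)
    convert this using 1
    rw [sub_smul]
    abel
  have hx : (extChartAt (𝓡 (n + 1)) x).symm (y₀ - (0 : ℝ) • e) = x := by simp [hy₀]
  refine ⟨fun i ↦ (extChartAt (𝓡 (n + 1)) x).symm (y₀ - (k / ((i : ℝ) + 1)) • e), ?_, ?_, ?_⟩
  · have h1 : Tendsto (fun i : ℕ ↦ k / ((i : ℝ) + 1)) atTop (𝓝 0) := by
      simpa [div_eq_mul_inv] using (tendsto_one_div_add_atTop_nhds_zero_nat (𝕜 := ℝ)).const_mul k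
    have h2 : Tendsto (fun i : ℕ ↦ y₀ - (k / ((i : ℝ) + 1)) • e) atTop (𝓝 y₀) := by
      simpa using (h1.smul_const e).const_sub y₀
    exact (extChartAt_symm_tendsto x (mem_extChartAt_source x)).comp h2
  · intro i
    refine .single (hseg _ _ (by positivity) ?_ (div_le_self hk0.le (by simp)))
    push_cast
    gcongr
    linarith
  · intro i
    have := hseg 0 (k / ((i : ℝ) + 1)) le_rfl (by positivity) (div_le_self hk0.le (by simp))
    rw [hx] at this
    exact .single this

/-- In a small ball of a chart the timelike cones are separated from a fixed hyperplane `τ = 0`. -/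
lemma exists_chart_cone (x : M) :
    ∃ r > 0, ∃ κ > 0, ∃ (τ : EuclideanSpace ℝ (Fin (n + 1)) →L[ℝ] ℝ)
      (e : EuclideanSpace ℝ (Fin (n + 1))) (L : NNReal),
      Metric.ball (extChartAt (𝓡 (n + 1)) x x) r ⊆ (extChartAt (𝓡 (n + 1)) x).target ∧ 0 < τ e ∧
      LipschitzOnWith L (S.chartMetric x) (Metric.ball (extChartAt (𝓡 (n + 1)) x x) r) ∧
      ∀ y ∈ Metric.ball (extChartAt (𝓡 (n + 1)) x x) r, S.chartMetric x y e e < 0 ∧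
        ∀ v, S.chartMetric x y v v < 0 →
          (S.chartOrient x y v < 0 ↔ 0 < τ v) ∧
          (0 < τ v → κ * ‖v‖ ≤ τ v ∧ S.chartMetric x y v e ≤ -(κ * ‖v‖)) := by
  obtain ⟨e, he⟩ := S.exists_chartFrame_eq_orient x
  set y₀ := extChartAt (𝓡 (n + 1)) x x with hy₀
  have hy₀t : y₀ ∈ (extChartAt (𝓡 (n + 1)) x).target := mem_extChartAt_target x
  have ho := (isOpen_extChartAt_target (I := 𝓡 (n + 1)) x).mem_nhds hy₀t
  have hGd := (S.contDiffOn_chartMetric x).contDiffAt ho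
  have hFG : S.chartOrient x y₀ = S.chartMetric x y₀ e := by
    ext v
    change S.metric _ _ (chartFrame x y₀ v) = S.metric _ (chartFrame x y₀ e) (chartFrame x y₀ v)
    rw [he]
  have hee : S.chartMetric x y₀ e e < 0 := by
    change S.metric _ (chartFrame x y₀ e) (chartFrame x y₀ e) < 0
    rw [he]
    exact S.orient_timelike _
  have hpos : ∀ w, S.chartMetric x y₀ e w = 0 → w ≠ 0 → 0 < S.chartMetric x y₀ w w := by
    intro w hw hw0
    change S.metric _ (chartFrame x y₀ e) (chartFrame x y₀ w) = 0 at hw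
    rw [he] at hw
    refine S.metric_lorentzian _ _ hw fun h0 ↦ hw0 ?_
    exact (chartFrame_bijective x hy₀t).1 (h0.trans (map_zero _).symm)
  obtain ⟨κ, hκ, hev⟩ := exists_uniform_cone hGd.continuousAt
    ((S.continuousOn_chartOrient x).continuousAt ho) (S.chartMetric_symm x y₀) hee hpos hFG
  obtain ⟨L, t, ht, hL⟩ := (hGd.of_le (show (1 : WithTop ℕ∞) ≤ ∞ by simp)).exists_lipschitzOnWith
  obtain ⟨r, hr, hball⟩ := Metric.mem_nhds_iff.1 (inter_mem (inter_mem ht ho) hev)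
  -- The sign makes τ positive on future-directed timelike vectors.
  refine ⟨r, hr, κ, hκ, -S.chartMetric x y₀ e, e, L, fun y hy ↦ (hball hy).1.2, ?_,
    hL.mono fun y hy ↦ (hball hy).1.1, fun y hy ↦ ?_⟩
  · simpa using hee
  · simpa only [_root_.neg_apply, Left.neg_pos_iff, mem_ofPred_eq] using (hball hy).2

/-- `p` and `q` are joined by a future-directed timelike curve that stays in `W`. -/
def TimelikeSegmentIn (W : Set M) (p q : M) : Prop :=
  ∃ γ : ℝ → M, S.IsTimelikeCurve γ ∧ γ 0 = p ∧ γ 1 = q ∧ ∀ t ∈ Icc (0 : ℝ) 1, γ t ∈ W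

variable {S}

lemma TimelikeSegmentIn.left_mem {W : Set M} {p q : M} (h : S.TimelikeSegmentIn W p q) : p ∈ W := by
  obtain ⟨γ, -, rfl, -, h⟩ := h
  exact h 0 (by simp)

lemma TimelikeSegmentIn.right_mem {W : Set M} {p q : M} (h : S.TimelikeSegmentIn W p q) :
    q ∈ W := by
  obtain ⟨γ, -, -, rfl, h⟩ := h
  exact h 1 (by simp)

variable (S)

/-- Locally, a limit `p` of points of the past of `r'` is in the past of each point of the future
of `r'`. -/
lemma exists_nhds_chron_of_frequently (x : M) :
    ∃ W ∈ 𝓝 x, ∀ p ∈ W, ∀ r' r, S.Chron r' r →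
      (∃ᶠ p' in 𝓝 p, Relation.TransGen (S.TimelikeSegmentIn W) p' r') → S.Chron p r := by
  obtain ⟨r, hr, κ, hκ, τ, e, L, hBt, hτe, hL, hcone⟩ := S.exists_chart_cone x
  set φ := extChartAt (𝓡 (n + 1)) x with hφ
  set B := Metric.ball (φ x) r with hB
  obtain ⟨C, hC, h₀, hh₀, htilt⟩ := exists_tilt_timelike hκ hL
    (fun y _ ↦ S.chartMetric_symm x y) (fun y hy ↦ (hcone y hy).1) hτe
    (fun y hy v hv ↦ ((hcone y hy).2 v hv).2)
  -- Two points of the ρ-ball are less than 2ρ apart, so the second bound makes the tilt in Φ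
  -- displace points by at most h. Thus Φ moves points by at most 2 h, and ρ ≤ r / 2 with h < r / 4
  -- keeps the images in B.
  set ρ := min (r / 2) (1 / (2 * (C * ‖τ‖ * ‖e‖ + 1))) with hρdef
  have hρ : 0 < ρ := by positivity
  have hρC : 2 * ρ * (C * ‖τ‖ * ‖e‖) ≤ 1 := by
    have h1 : ρ ≤ 1 / (2 * (C * ‖τ‖ * ‖e‖ + 1)) := min_le_right _ _
    rw [le_div_iff₀ (by positivity)] at h1
    nlinarith
  set W := φ.source ∩ φ ⁻¹' Metric.ball (φ x) ρ with hW
  have hWx : W ∈ 𝓝 x := inter_mem (extChartAt_source_mem_nhds x)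
    ((continuousAt_extChartAt x).preimage_mem_nhds (Metric.ball_mem_nhds _ hρ))
  refine ⟨W, hWx, fun p hp r' q hrq hfreq ↦ ?_⟩
  have hr' : r' ∈ W := by
    obtain ⟨p', hp'⟩ := hfreq.exists
    obtain ⟨b, -, hb⟩ := Relation.TransGen.tail'_iff.1 hp'
    exact hb.right_mem
  -- Φ p' sends φ p' to φ p, and its differential v ↦ v + h C τ(v) e is the tilt of
  -- `exists_tilt_timelike`. As p' tends to p, the image of φ r' tends to φ r', so it ends up in the
  -- open past of q.
  set Φ : M → EuclideanSpace ℝ (Fin (n + 1)) → EuclideanSpace ℝ (Fin (n + 1)) :=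
    fun p' y ↦ y + (φ p - φ p') + (‖φ p - φ p'‖ * C * τ (y - φ p')) • e with hΦ
  have hφp : ContinuousAt φ p := continuousAt_extChartAt' hp.1
  have hΦr : ContinuousAt (fun p' ↦ Φ p' (φ r')) p := by
    simp only [hΦ]
    fun_prop
  have hΦr0 : Φ p (φ r') = φ r' := by simp [hΦ]
  have hev1 : ∀ᶠ p' in 𝓝 p, S.Chron (φ.symm (Φ p' (φ r'))) q := by
    have h1 : Tendsto (fun p' ↦ Φ p' (φ r')) (𝓝 p) (𝓝 (φ r')) := by
      simpa only [ContinuousAt, hΦr0] using hΦr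
    exact ((extChartAt_symm_tendsto x hr'.1).comp h1).eventually
      ((S.isOpen_IMinus q).mem_nhds hrq)
  have hev2 : ∀ᶠ p' in 𝓝 p, ‖φ p - φ p'‖ < min h₀ (r / 4) := by
    have h1 : ContinuousAt (fun p' ↦ ‖φ p - φ p'‖) p := by fun_prop
    exact h1.eventually_lt continuousAt_const (by simp [hh₀, hr])
  obtain ⟨p', hp', hp'q, hp'h⟩ := (hfreq.and_eventually (hev1.and hev2)).exists
  have hp'W : p' ∈ W := by
    obtain ⟨b, hb, -⟩ := Relation.TransGen.head'_iff.1 hp'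
    exact hb.left_mem
  set h := ‖φ p - φ p'‖ with hh
  have hh0 : 0 ≤ h := norm_nonneg _
  have hΦW : ∀ y ∈ Metric.ball (φ x) ρ, ‖Φ p' y - y‖ ≤ 2 * h := by
    intro y hy
    have h1 : ‖y - φ p'‖ ≤ 2 * ρ := by
      have := dist_triangle_right y (φ p') (φ x)
      have h2 : dist y (φ x) < ρ := hy
      have h3 : dist (φ p') (φ x) < ρ := hp'W.2
      rw [dist_eq_norm] at this
      linarith
    have h2 : ‖(h * C * τ (y - φ p')) • e‖ ≤ h := by
      rw [norm_smul, norm_mul, norm_mul, Real.norm_of_nonneg hh0, Real.norm_of_nonneg hC.le]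
      calc h * C * ‖τ (y - φ p')‖ * ‖e‖ ≤ h * C * (‖τ‖ * (2 * ρ)) * ‖e‖ := by
            gcongr
            exact (τ.le_opNorm _).trans (by gcongr)
        _ = h * (2 * ρ * (C * ‖τ‖ * ‖e‖)) := by ring
        _ ≤ h * 1 := by gcongr
        _ = h := mul_one h
    have h3 : Φ p' y - y = (φ p - φ p') + (h * C * τ (y - φ p')) • e := by
      simp only [hΦ, ← hh]
      abel
    rw [h3]
    exact (norm_add_le _ _).trans (by linarith)
  have hρr : ρ ≤ r / 2 := min_le_left _ _
  have hh4 : h < r / 4 := hp'h.trans_le (min_le_right _ _)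
  have hΦB : ∀ y ∈ Metric.ball (φ x) ρ, Φ p' y ∈ B := by
    intro y hy
    have h1 := hΦW y hy
    have h2 : dist y (φ x) < ρ := hy
    rw [hB, Metric.mem_ball]
    have h3 := dist_triangle (Φ p' y) y (φ x)
    rw [dist_eq_norm (Φ p' y) y] at h3
    linarith
  have hsub : Metric.ball (φ x) ρ ⊆ B := Metric.ball_subset_ball (by linarith)
  have hlift : ∀ a b, S.TimelikeSegmentIn W a b →
      S.TimelikeSegment (φ.symm (Φ p' (φ a))) (φ.symm (Φ p' (φ b))) := by
    rintro _ _ ⟨γ, hγ, rfl, rfl, hγW⟩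
    have hsrc : ∀ t ∈ Icc (0 : ℝ) 1, γ t ∈ φ.source := fun t ht ↦ (hγW t ht).1
    have hcd : ContDiffOn ℝ 1 (φ ∘ γ) (Icc 0 1) := contDiffOn_chart_comp x hγ.1 hsrc
    have hcd' : ContDiffOn ℝ 1 (fun t ↦ Φ p' ((φ ∘ γ) t)) (Icc 0 1) := by
      simp only [hΦ]
      generalize φ ∘ γ = c at hcd
      fun_prop
    refine timelikeSegment_of_chart S x (c := fun t ↦ Φ p' ((φ ∘ γ) t)) hcd'
      (fun t ht ↦ hBt (hΦB _ (hγW t ht).2)) fun t ht ↦ ?_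
    have hfut := S.chartTimelike_chart_comp x hγ.1 hsrc hγ.2 ht
    set v := derivWithin (φ ∘ γ) (Icc 0 1) t with hv
    have hd : HasDerivWithinAt (φ ∘ γ) v (Icc 0 1) t :=
      (hcd.differentiableOn (by simp) t ht).hasDerivWithinAt
    have hd' : HasDerivWithinAt (fun t ↦ Φ p' ((φ ∘ γ) t)) (v + (h * C * τ v) • e) (Icc 0 1) t := by
      have h1 := (τ.hasFDerivAt.comp_hasDerivWithinAt t (hd.sub_const (φ p'))).const_mul (h * C)
      exact (hd.add_const (φ p - φ p')).add (h1.smul_const e)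
    rw [hd'.derivWithin (uniqueDiffOn_Icc zero_lt_one t ht)]
    have hyB : φ (γ t) ∈ B := hsub (hγW t ht).2
    have hyB' : Φ p' (φ (γ t)) ∈ B := hΦB _ (hγW t ht).2
    have hτv := ((hcone _ hyB).2 v hfut.1).1.1 hfut.2
    obtain ⟨h1, h2⟩ := htilt h hh0 (hp'h.trans_le (min_le_left _ _)).le _ hyB _ hyB'
      (hΦW _ (hγW t ht).2) v hfut.1 hτv
    exact ⟨h1, ((hcone _ hyB').2 _ h1).1.2 h2⟩
  have hchron : S.Chron (φ.symm (Φ p' (φ p'))) (φ.symm (Φ p' (φ r'))) :=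
    Relation.TransGen.lift (fun a ↦ φ.symm (Φ p' (φ a))) hlift _ _ hp'
  have hp'p : φ.symm (Φ p' (φ p')) = p := by
    simp [hΦ, φ.left_inv hp.1]
  rw [hp'p] at hchron
  exact hchron.trans hp'q

end Spacetime

/-! ### Frontier crossing and closed transitive hulls -/

lemma IsPreconnected.exists_mem_frontier {X : Type*} [TopologicalSpace X] {t V : Set X}
    (ht : IsPreconnected t) {a b : X} (ha : a ∈ t) (haV : a ∈ V) (hb : b ∈ t) (hbV : b ∉ V) :
    (t ∩ frontier V).Nonempty := by
  by_contra! h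
  have hnot : ∀ z ∈ t, z ∉ frontier V := fun z hz hzV ↦ (h ▸ ⟨hz, hzV⟩ : z ∈ (∅ : Set X))
  have hor : ∀ z ∈ t, z ∈ interior V ∨ z ∈ (closure V)ᶜ := by
    intro z hz
    by_contra! hcon
    exact hnot z hz ⟨not_not.1 hcon.2, hcon.1⟩
  obtain ⟨z, -, hz1, hz2⟩ := ht _ _ isOpen_interior isClosed_closure.isOpen_compl hor
    ⟨a, ha, (hor a ha).resolve_right fun h ↦ h (subset_closure haV)⟩
    ⟨b, hb, (hor b hb).resolve_left fun h ↦ hbV (interior_subset h)⟩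
  exact hz2 (interior_subset_closure hz1)

section ClosedTransHull

variable {M : Type*} [TopologicalSpace M] {R : M → M → Prop}

lemma closedTransHull_of_rel {p q : M} (h : R p q) : closedTransHull R p q :=
  fun _ _ _ hR ↦ hR p q h

lemma closedTransHull_trans {p q r : M} (h : closedTransHull R p q) (h' : closedTransHull R q r) :
    closedTransHull R p r :=
  fun S hS hT hR ↦ hT p q r (h S hS hT hR) (h' S hS hT hR)

variable (R) in
lemma isClosed_closedTransHull : IsClosed {p : M × M | closedTransHull R p.1 p.2} := by
  have : {p : M × M | closedTransHull R p.1 p.2} =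
      ⋂₀ {S | IsClosed S ∧ (∀ a b c, (a, b) ∈ S → (b, c) ∈ S → (a, c) ∈ S) ∧
        ∀ a b, R a b → (a, b) ∈ S} := by
    ext ⟨p, q⟩
    simp [closedTransHull]
  rw [this]
  exact isClosed_sInter fun S hS ↦ hS.1

lemma closedTransHull_swap_of {p q : M} (h : closedTransHull (fun a b ↦ R b a) p q) :
    closedTransHull R q p :=
  fun S hS hT hR ↦ h (Prod.swap ⁻¹' S) (hS.preimage continuous_swap)
    (fun a b c h1 h2 ↦ hT c b a h2 h1) (fun a b hab ↦ hR b a hab)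

lemma closedTransHull_swap {p q : M} :
    closedTransHull (fun a b ↦ R b a) p q ↔ closedTransHull R q p :=
  ⟨closedTransHull_swap_of, closedTransHull_swap_of⟩

lemma isClosed_closedTransHull_left (q : M) : IsClosed {p | closedTransHull R p q} :=
  (isClosed_closedTransHull R).preimage (f := fun p ↦ (p, q)) (by fun_prop)

lemma isClosed_closedTransHull_right (p : M) : IsClosed {q | closedTransHull R p q} :=
  (isClosed_closedTransHull R).preimage (f := fun q ↦ (p, q)) (by fun_prop)

/-- The set is the projection of a closed set along the compact factor C, and such a projection is a
closed map. -/
lemma isClosed_exists_between {C : Set M} (hC : IsCompact C) :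
    IsClosed {p : M × M | ∃ z ∈ C, closedTransHull R p.1 z ∧ closedTransHull R z p.2} := by
  have : CompactSpace C := isCompact_iff_compactSpace.1 hC
  have hR := isClosed_closedTransHull R
  have hD : IsClosed ({p : (M × M) × C | closedTransHull R p.1.1 p.2} ∩
      {p : (M × M) × C | closedTransHull R p.2 p.1.2}) :=
    (hR.preimage (f := fun p : (M × M) × C ↦ (p.1.1, (p.2 : M))) (by fun_prop)).inter
      (hR.preimage (f := fun p : (M × M) × C ↦ ((p.2 : M), p.1.2)) (by fun_prop))
  convert isClosedMap_fst_of_compactSpace _ hD using 1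
  ext ⟨p, q⟩
  simp only [mem_ofPred_eq, mem_image, mem_inter_iff, Prod.exists, Subtype.exists,
    exists_and_right, exists_eq_right]
  exact ⟨fun ⟨z, hz, h, h'⟩ ↦ ⟨z, ⟨hz, h⟩, h'⟩, fun ⟨z, ⟨hz, h⟩, h'⟩ ↦ ⟨z, hz, h, h'⟩⟩

/-- If the generating pairs that leave an open set cross its frontier, so do the pairs of the
closed transitive hull. -/
lemma exists_frontier_between (hrefl : ∀ p, closedTransHull R p p) {V : Set M} (hV : IsOpen V)
    (hC : IsCompact (frontier V))
    (hR : ∀ a b, R a b → a ∈ V → b ∉ V →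
      ∃ z ∈ frontier V, closedTransHull R a z ∧ closedTransHull R z b)
    {p q : M} (hpq : closedTransHull R p q) (hp : p ∈ V) (hq : q ∉ V) :
    ∃ z ∈ frontier V, closedTransHull R p z ∧ closedTransHull R z q := by
  set Z := {p : M × M | ∃ z ∈ frontier V, closedTransHull R p.1 z ∧ closedTransHull R z p.2}
    with hZ
  -- The closure of V replaces V to make T closed. Nothing is lost: an endpoint in the closure but
  -- not in V is itself a frontier point between, by reflexivity.
  set T := {p : M × M | closedTransHull R p.1 p.2} ∩
    (Prod.fst ⁻¹' Vᶜ ∪ Prod.snd ⁻¹' closure V ∪ Z) with hT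
  have hcross : ∀ a b, (a, b) ∈ T → a ∈ V → b ∉ V → (a, b) ∈ Z := by
    rintro a b ⟨hab, (h | h) | h⟩ ha hb
    · exact absurd ha h
    · refine ⟨b, ?_, hab, hrefl b⟩
      rw [hV.frontier_eq]
      exact ⟨h, hb⟩
    · exact h
  have hmem : ∀ a b, closedTransHull R a b → (a ∈ V → b ∉ V → (a, b) ∈ Z) → (a, b) ∈ T := by
    intro a b hab h
    refine ⟨hab, ?_⟩
    by_cases ha : a ∈ V
    · by_cases hb : b ∈ V
      · exact .inl (.inr (subset_closure hb))
      · exact .inr (h ha hb)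
    · exact .inl (.inl ha)
  refine hcross p q (hpq T ?_ ?_ ?_) hp hq
  · exact (isClosed_closedTransHull R).inter (((hV.isClosed_compl.preimage continuous_fst).union
      (isClosed_closure.preimage continuous_snd)).union (isClosed_exists_between hC))
  · intro a b c hab hbc
    refine hmem a c (closedTransHull_trans hab.1 hbc.1) fun ha hc ↦ ?_
    by_cases hb : b ∈ V
    · obtain ⟨z, hz, h1, h2⟩ := hcross b c hbc hb hc
      exact ⟨z, hz, closedTransHull_trans hab.1 h1, h2⟩
    · obtain ⟨z, hz, h1, h2⟩ := hcross a b hab ha hb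
      exact ⟨z, hz, h1, closedTransHull_trans h2 hbc.1⟩
  · exact fun a b hab ↦ hmem a b (closedTransHull_of_rel hab) (hR a b hab)

end ClosedTransHull

/-! ### The relation K⁺, K-causality and order intervals -/

namespace Spacetime

variable {n : ℕ} {M : Type*} [TopologicalSpace M]
  [ChartedSpace (EuclideanSpace ℝ (Fin (n + 1))) M] [IsManifold (𝓡 (n + 1)) ∞ M]
  {S : Spacetime n M}

lemma Chron.kFut {p q : M} (h : S.Chron p q) : S.KFut p q :=
  closedTransHull_of_rel h

lemma KFut.trans {p q r : M} (h : S.KFut p q) (h' : S.KFut q r) : S.KFut p r :=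
  closedTransHull_trans h h'

lemma KFut.refl (p : M) : S.KFut p p := by
  obtain ⟨y, hy, -, hyp⟩ := S.exists_seq_chron_tendsto p
  exact (isClosed_closedTransHull_left (R := fun p q ↦ q ∈ S.IPlus p) p).mem_of_tendsto hy
    (Eventually.of_forall fun i ↦ (hyp i).kFut)

lemma rev_kFut {p q : M} : S.rev.KFut p q ↔ S.KFut q p := by
  simp only [KFut, rev_IPlus]
  exact closedTransHull_swap (R := fun p q ↦ q ∈ S.IPlus p)

lemma kPast_eq : S.KPast = S.rev.KFut := by
  simp only [KFut, KPast, rev_IPlus]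

lemma kMinus_eq (p : M) : S.KMinus p = S.rev.KPlus p := by
  simp only [KMinus, KPlus, kPast_eq]

lemma aMinus_eq (p : M) : S.AMinus p = S.rev.APlus p := by
  simp only [AMinus, APlus, kMinus_eq, kPast_eq]

lemma KCausal.rev (hK : S.KCausal) : S.rev.KCausal := fun p q h h' ↦
  hK p q (rev_kFut.1 h') (rev_kFut.1 h)

lemma IsTimelikeCurve.kFut_left {γ : ℝ → M} (hγ : S.IsTimelikeCurve γ) {t : ℝ}
    (ht : t ∈ Icc (0 : ℝ) 1) : S.KFut (γ 0) (γ t) := by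
  rcases ht.1.eq_or_lt with rfl | h
  · exact .refl _
  · exact Chron.kFut (.single (hγ.timelikeSegment_of_lt le_rfl h ht.2))

lemma IsTimelikeCurve.kFut_right {γ : ℝ → M} (hγ : S.IsTimelikeCurve γ) {t : ℝ}
    (ht : t ∈ Icc (0 : ℝ) 1) : S.KFut (γ t) (γ 1) := by
  rcases ht.2.eq_or_lt with rfl | h
  · exact .refl _
  · exact Chron.kFut (.single (hγ.timelikeSegment_of_lt ht.1 h le_rfl))

lemma Chron.exists_frontier {V : Set M} {p q : M} (h : S.Chron p q) (hp : p ∈ V) (hq : q ∉ V) :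
    ∃ z ∈ frontier V, S.KFut p z ∧ S.KFut z q := by
  have hseg : ∀ a b, S.TimelikeSegment a b → a ∈ V → b ∉ V →
      ∃ z ∈ frontier V, S.KFut a z ∧ S.KFut z b := by
    rintro _ _ ⟨γ, h1, rfl, rfl, h2⟩ ha hb
    have hγ : S.IsTimelikeCurve γ := ⟨h1, h2⟩
    obtain ⟨_, ⟨t, ht, rfl⟩, hz⟩ :=
      (isPreconnected_Icc.image γ h1.continuousOn).exists_mem_frontier
        ⟨0, by simp, rfl⟩ ha ⟨1, by simp, rfl⟩ hb
    exact ⟨_, hz, hγ.kFut_left ht, hγ.kFut_right ht⟩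
  induction h with
  | single h => exact hseg _ _ h hp hq
  | @tail b c hab hbc ih =>
    by_cases hb : b ∈ V
    · obtain ⟨z, hz, h1, h2⟩ := hseg _ _ hbc hb hq
      exact ⟨z, hz, (Chron.kFut hab).trans h1, h2⟩
    · obtain ⟨z, hz, h1, h2⟩ := ih hb
      exact ⟨z, hz, h1, h2.trans (Chron.kFut (.single hbc))⟩

lemma KFut.exists_frontier {V : Set M} (hV : IsOpen V) (hC : IsCompact (frontier V)) {p q : M}
    (h : S.KFut p q) (hp : p ∈ V) (hq : q ∉ V) :
    ∃ z ∈ frontier V, S.KFut p z ∧ S.KFut z q :=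
  exists_frontier_between (R := fun p q ↦ q ∈ S.IPlus p) KFut.refl hV hC
    (fun _ _ hab ↦ Chron.exists_frontier hab) h hp hq

/-- Entering V amounts to leaving the open complement of its closure, unless p already lies on the
frontier. -/
lemma KFut.exists_frontier' {V : Set M} (hC : IsCompact (frontier V)) {p q : M}
    (h : S.KFut p q) (hp : p ∉ V) (hq : q ∈ V) :
    ∃ z ∈ frontier V, S.KFut p z ∧ S.KFut z q := by
  by_cases hpV : p ∈ closure V
  · exact ⟨p, ⟨hpV, fun h ↦ hp (interior_subset h)⟩, .refl p, h⟩
  · have hsub : frontier (closure V)ᶜ ⊆ frontier V := by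
      rw [frontier_compl]
      exact frontier_closure_subset
    obtain ⟨z, hz, h'⟩ := h.exists_frontier isClosed_closure.isOpen_compl
      (hC.of_isClosed_subset isClosed_frontier hsub) hpV (fun h ↦ h (subset_closure hq))
    exact ⟨z, hsub hz, h'⟩

variable (S) in
/-- The order interval `{r | p ≺ r ≺ q}`. -/
def KInterval (p q : M) : Set M := {r | S.KFut p r ∧ S.KFut r q}

lemma rev_kInterval (p q : M) : S.rev.KInterval p q = S.KInterval q p := by
  ext r
  simp only [KInterval, rev_kFut, mem_ofPred_eq]
  exact and_comm

/-- Pairs with a point of the compact frontier between them form a closed set, which misses (p, q).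
For nearby pairs, an interval point outside W would produce such a frontier point. -/
lemma eventually_kInterval_subset {W : Set M} (hW : IsOpen W) (hC : IsCompact (frontier W))
    {p q : M} (hp : p ∈ W) (h : S.KInterval p q ⊆ W) :
    ∀ᶠ x in 𝓝 (p, q), S.KInterval x.1 x.2 ⊆ W := by
  have h1 : (p, q) ∉ {x : M × M | ∃ z ∈ frontier W, S.KFut x.1 z ∧ S.KFut z x.2} := by
    rintro ⟨z, hz, hpz⟩
    rw [hW.frontier_eq] at hz
    exact hz.2 (h hpz)
  have h2 : IsClosed {x : M × M | ∃ z ∈ frontier W, S.KFut x.1 z ∧ S.KFut z x.2} :=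
    isClosed_exists_between hC
  filter_upwards [h2.isOpen_compl.mem_nhds h1,
    (hW.preimage continuous_fst).mem_nhds (show (p, q) ∈ Prod.fst ⁻¹' W from hp)] with x hx hxW
  intro r hr
  by_contra hrW
  obtain ⟨z, hz, h3, h4⟩ := hr.1.exists_frontier hW hC hxW hrW
  exact hx ⟨z, hz, h3, h4.trans hr.2⟩

/-- Every point of a timelike curve lies in the order interval of its endpoints. -/
lemma Chron.transGen_timelikeSegmentIn {W : Set M} {p q : M} (h : S.Chron p q)
    (hW : S.KInterval p q ⊆ W) : Relation.TransGen (S.TimelikeSegmentIn W) p q := by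
  have hseg : ∀ a b, S.TimelikeSegment a b → S.KInterval a b ⊆ W →
      S.TimelikeSegmentIn W a b := by
    rintro _ _ ⟨γ, h1, rfl, rfl, h2⟩ hab
    have hγ : S.IsTimelikeCurve γ := ⟨h1, h2⟩
    exact ⟨γ, hγ, rfl, rfl, fun t ht ↦ hab ⟨hγ.kFut_left ht, hγ.kFut_right ht⟩⟩
  induction h with
  | single h => exact .single (hseg _ _ h hW)
  | @tail b c hab hbc ih =>
    refine .tail (ih fun r hr ↦ hW ⟨hr.1, hr.2.trans (Chron.kFut (.single hbc))⟩)
      (hseg _ _ hbc fun r hr ↦ hW ⟨(Chron.kFut hab).trans hr.1, hr.2⟩)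

lemma Chron.exists_between {p q : M} (h : S.Chron p q) : ∃ r, S.Chron p r ∧ S.Chron r q := by
  obtain ⟨y, hy, -, hyq⟩ := S.exists_seq_chron_tendsto q
  obtain ⟨i, hi⟩ := (hy.eventually ((S.isOpen_IPlus p).mem_nhds h)).exists
  exact ⟨y i, hi, hyq i⟩

variable (S) in
/-- Locally, the interior of `K⁺(p)` consists of points of `I⁺(p)`. -/
lemma exists_nhds_chron_of_mem_interior (x : M) :
    ∃ W₀ ∈ 𝓝 x, ∀ W ⊆ W₀, IsOpen W → IsCompact (frontier W) → ∀ p q, q ∈ interior (S.KPlus p) →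
      S.KInterval p q ⊆ W → S.Chron p q := by
  obtain ⟨W₀, hW₀, hlim⟩ := S.exists_nhds_chron_of_frequently x
  refine ⟨W₀, hW₀, fun W hWW hW hC p q hq hpq ↦ ?_⟩
  set T : Set (M × M) := {a | S.KFut a.1 a.2 ∧
    ∀ r, S.Chron a.2 r → S.KInterval a.1 r ⊆ W → S.Chron a.1 r} with hT
  have hKT : ∀ a b, S.KFut a b → (a, b) ∈ T := by
    intro a b hab
    refine hab T ?_ ?_ ?_
    · rw [isClosed_iff_frequently]
      rintro ⟨a, b⟩ hfreq
      have hK : S.KFut a b :=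
        isClosed_iff_frequently.1 (isClosed_closedTransHull _) (a, b) (hfreq.mono fun _ h ↦ h.1)
      refine ⟨hK, fun r hbr har ↦ ?_⟩
      -- The intermediate r' gives room for the limit: nearby pairs reach r' by curves in W, and the
      -- limit point a then reaches the later point r.
      obtain ⟨r', hbr', hr'r⟩ := hbr.exists_between
      have haW : a ∈ W := har ⟨.refl a, hK.trans hbr.kFut⟩
      have har' : S.KInterval a r' ⊆ W := fun z hz ↦ har ⟨hz.1, hz.2.trans hr'r.kFut⟩
      have hev1 : ∀ᶠ c in 𝓝 (a, b), S.KInterval c.1 r' ⊆ W := by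
        have : Tendsto (fun c : M × M ↦ (c.1, r')) (𝓝 (a, b)) (𝓝 (a, r')) :=
          Continuous.tendsto' (by fun_prop) _ _ rfl
        exact this.eventually (eventually_kInterval_subset hW hC haW har')
      have hev2 : ∀ᶠ c in 𝓝 (a, b), S.Chron c.2 r' :=
        (continuous_snd.tendsto (a, b)).eventually ((S.isOpen_IMinus r').mem_nhds hbr')
      refine hlim a (hWW haW) r' r hr'r ?_
      refine (continuous_fst.tendsto (a, b)).frequently ?_
      refine (hfreq.and_eventually (hev1.and hev2)).mono ?_
      rintro c ⟨hc, hc1, hc2⟩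
      exact (hc.2 r' hc2 hc1).transGen_timelikeSegmentIn (hc1.trans hWW)
    · rintro a b c ⟨hab, hab'⟩ ⟨hbc, hbc'⟩
      refine ⟨hab.trans hbc, fun r hcr har ↦ hab' r (hbc' r hcr ?_) har⟩
      exact fun z hz ↦ har ⟨hab.trans hz.1, hz.2⟩
    · exact fun a b hab ↦ ⟨Chron.kFut hab, fun r hbr _ ↦ Relation.TransGen.trans hab hbr⟩
  -- Since q is interior, some y i in its past is still in K⁺(p); T applied to (p, y i) with r = q
  -- concludes.
  obtain ⟨y, hy, -, hyq⟩ := S.exists_seq_chron_tendsto q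
  obtain ⟨i, hi⟩ := (hy.eventually (mem_interior_iff_mem_nhds.1 hq)).exists
  exact (hKT p (y i) hi).2 q (hyq i) hpq

lemma IPlus_subset_interior_KPlus (p : M) : S.IPlus p ⊆ interior (S.KPlus p) :=
  interior_maximal (fun _ h ↦ Chron.kFut h) (S.isOpen_IPlus p)

lemma exists_isOpen_isCompact_frontier [T2Space M] (n : ℕ)
    [ChartedSpace (EuclideanSpace ℝ (Fin (n + 1))) M] {x : M} {U : Set M} (hU : U ∈ 𝓝 x) :
    ∃ V ⊆ U, IsOpen V ∧ x ∈ V ∧ IsCompact (frontier V) := by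
  have : LocallyCompactSpace M :=
    ChartedSpace.locallyCompactSpace (EuclideanSpace ℝ (Fin (n + 1))) M
  obtain ⟨K, hK, hKU, hKc⟩ := local_compact_nhds hU
  refine ⟨interior K, interior_subset.trans hKU, isOpen_interior, mem_interior_iff_mem_nhds.2 hK,
    hKc.of_isClosed_subset isClosed_frontier ?_⟩
  exact frontier_subset_closure.trans (closure_minimal interior_subset hKc.isClosed)

/-- In a `K`-causal spacetime, an increasing sequence converges to its supremum. -/
lemma KCausal.tendsto_of_isSupSeq [T2Space M] (hK : S.KCausal) {y : ℕ → M} {x : M}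
    (hy : ∀ i, S.KFut (y i) (y (i + 1))) (hx : IsSupSeq S.KFut y x) : Tendsto y atTop (𝓝 x) := by
  intro U hU
  obtain ⟨V, hVU, hV, hxV, hC⟩ := exists_isOpen_isCompact_frontier n hU
  suffices h : ∀ᶠ i in atTop, y i ∈ V from h.mono fun i hi ↦ hVU hi
  by_contra hfreq
  rw [not_eventually] at hfreq
  set F : ℕ → Set M := fun i ↦ frontier V ∩ ({z | S.KFut (y i) z} ∩ {z | S.KFut z x}) with hF
  have hFc : ∀ i, IsClosed (F i) := fun i ↦ isClosed_frontier.inter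
    ((isClosed_closedTransHull_right _).inter (isClosed_closedTransHull_left _))
  have hFs : ∀ i, F (i + 1) ⊆ F i := fun i z hz ↦ ⟨hz.1, (hy i).trans hz.2.1, hz.2.2⟩
  have hFn : ∀ i, (F i).Nonempty := by
    intro i
    obtain ⟨j, hij, hj⟩ := frequently_atTop.1 hfreq i
    obtain ⟨z, hz, h1, h2⟩ := (hx.1 j).exists_frontier' hC hj hxV
    exact ⟨z, antitone_nat_of_succ_le hFs hij ⟨hz, h1, h2⟩⟩
  -- A common frontier point z is an upper bound of the sequence with z ≺ x. As x is the supremum, x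
  -- ≺ z, so z = x, which is not on the frontier.
  obtain ⟨z, hz⟩ := IsCompact.nonempty_iInter_of_sequence_nonempty_isCompact_isClosed F hFs hFn
    (hC.of_isClosed_subset (hFc 0) inter_subset_left) hFc
  rw [mem_iInter] at hz
  obtain rfl := hK x z (hx.2 z fun i ↦ (hz i).2.1) (hz 0).2.2
  have := (hz 0).1
  rw [hV.frontier_eq] at this
  exact this.2 hxV

lemma KCausal.aPlus_eq_interior [T2Space M] (hK : S.KCausal) (p : M) :
    S.APlus p = interior (S.KPlus p) := by
  ext x
  constructor
  · rintro ⟨hpx, hx⟩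
    by_contra hxi
    refine hx ⟨hpx, ?_⟩
    obtain ⟨y, hy, hyy, hyx⟩ := S.exists_seq_chron_tendsto x
    refine ⟨y, fun i ↦ (hyy i).kFut, fun i hi ↦ hxi ?_, fun i ↦ (hyx i).kFut, fun z hz ↦ ?_⟩
    · exact interior_maximal (fun z hz ↦ hi.trans (Chron.kFut hz)) (S.isOpen_IPlus (y i)) (hyx i)
    · exact (isClosed_closedTransHull_left z).mem_of_tendsto hy (Eventually.of_forall hz)
  · refine fun hx ↦ ⟨interior_subset hx, ?_⟩
    rintro ⟨-, y, hy, hyp, hyx⟩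
    obtain ⟨i, hi⟩ := ((hK.tendsto_of_isSupSeq hy hyx).eventually
      (mem_interior_iff_mem_nhds.1 hx)).exists
    exact hyp i hi

lemma KCausal.aMinus_eq_interior [T2Space M] (hK : S.KCausal) (p : M) :
    S.AMinus p = interior (S.KMinus p) := by
  rw [aMinus_eq, kMinus_eq, hK.rev.aPlus_eq_interior]

/-- K-causality shrinks the order interval of (x, x) to {x}, and containment in W persists for
nearby pairs. -/
lemma KCausal.exists_nhds_kInterval_subset (hK : S.KCausal) {W : Set M} (hW : IsOpen W)
    (hC : IsCompact (frontier W)) {x : M} (hx : x ∈ W) :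
    ∃ U ⊆ W, IsOpen U ∧ x ∈ U ∧ ∀ p ∈ U, ∀ q ∈ U, S.KInterval p q ⊆ W := by
  have hxx : S.KInterval x x ⊆ W := by
    rintro r ⟨h1, h2⟩
    rwa [← hK x r h1 h2]
  have hev := (eventually_kInterval_subset hW hC hx hxx)
  rw [nhds_prod_eq, eventually_prod_self_iff'] at hev
  obtain ⟨t, ht, hev⟩ := hev
  refine ⟨interior t ∩ W, inter_subset_right, isOpen_interior.inter hW,
    ⟨mem_interior_iff_mem_nhds.2 ht, hx⟩, fun p hp q hq ↦ ?_⟩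
  exact hev p (interior_subset hp.1) q (interior_subset hq.1)

end Spacetime

/-! ### The theorem -/

theorem lemma4 {n : ℕ} {M : Type*} [TopologicalSpace M] [T2Space M] [SecondCountableTopology M]
    [ChartedSpace (EuclideanSpace ℝ (Fin (n + 1))) M] [IsManifold (𝓡 (n + 1)) ∞ M]
    (S : Spacetime n M) (hK : S.KCausal) :
    (∀ p, IsOpen (S.APlus p) ∧ S.APlus p = interior (S.KPlus p)) ∧
    (∀ p, IsOpen (S.AMinus p) ∧ S.AMinus p = interior (S.KMinus p)) ∧
    (∀ p q, IsOpen (S.AInterval p q)) ∧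
    (∀ x, ∃ U : Set M, IsOpen U ∧ x ∈ U ∧
      (∀ p ∈ U, S.APlus p ∩ U = S.IPlus p ∩ U ∧ S.AMinus p ∩ U = S.IMinus p ∩ U) ∧
      (∀ p ∈ U, ∀ q ∈ U, S.AInterval p q = S.IInterval p q)) := by
  have hP : ∀ p, IsOpen (S.APlus p) := fun p ↦ hK.aPlus_eq_interior p ▸ isOpen_interior
  have hM : ∀ p, IsOpen (S.AMinus p) := fun p ↦ hK.aMinus_eq_interior p ▸ isOpen_interior
  refine ⟨fun p ↦ ⟨hP p, hK.aPlus_eq_interior p⟩, fun p ↦ ⟨hM p, hK.aMinus_eq_interior p⟩,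
    fun p q ↦ (hP p).inter (hM q), fun x ↦ ?_⟩
  have hIP : ∀ p, S.IPlus p ⊆ S.APlus p := fun p ↦ by
    rw [hK.aPlus_eq_interior]
    exact Spacetime.IPlus_subset_interior_KPlus p
  have hIM : ∀ p, S.IMinus p ⊆ S.AMinus p := fun p ↦ by
    rw [hK.aMinus_eq_interior, Spacetime.kMinus_eq, ← Spacetime.rev_IPlus]
    exact Spacetime.IPlus_subset_interior_KPlus p
  obtain ⟨W₁, hW₁, h₁⟩ := S.exists_nhds_chron_of_mem_interior x
  obtain ⟨W₂, hW₂, h₂⟩ := S.rev.exists_nhds_chron_of_mem_interior x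
  obtain ⟨W, hWW, hW, hxW, hC⟩ :=
    Spacetime.exists_isOpen_isCompact_frontier n (inter_mem hW₁ hW₂)
  obtain ⟨U, hUW, hU, hxU, hint⟩ := hK.exists_nhds_kInterval_subset hW hC hxW
  have hAP : ∀ p q, q ∈ S.APlus p → S.KInterval p q ⊆ W → q ∈ S.IPlus p := by
    intro p q hq hpq
    rw [hK.aPlus_eq_interior] at hq
    exact h₁ W (hWW.trans inter_subset_left) hW hC p q hq hpq
  have hAM : ∀ p q, q ∈ S.AMinus p → S.KInterval q p ⊆ W → q ∈ S.IMinus p := by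
    intro p q hq hpq
    rw [hK.aMinus_eq_interior, Spacetime.kMinus_eq] at hq
    rw [← Spacetime.rev_kInterval] at hpq
    rw [← Spacetime.rev_IPlus]
    exact h₂ W (hWW.trans inter_subset_right) hW hC p q hq hpq
  refine ⟨U, hU, hxU, fun p hp ↦ ⟨?_, ?_⟩, fun p hp q hq ↦ ?_⟩
  · exact Subset.antisymm (fun q hq ↦ ⟨hAP p q hq.1 (hint p hp q hq.2), hq.2⟩)
      (inter_subset_inter_left _ (hIP p))
  · exact Subset.antisymm (fun q hq ↦ ⟨hAM p q hq.1 (hint q hq.2 p hp), hq.2⟩)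
      (inter_subset_inter_left _ (hIM p))
  · refine Subset.antisymm (fun z hz ↦ ?_) (inter_subset_inter (hIP p) (hIM q))
    have hpz : S.KFut p z := hz.1.1
    have hzq : S.KFut z q := by
      have : S.KPast q z := hz.2.1
      rwa [Spacetime.kPast_eq, Spacetime.rev_kFut] at this
    -- Here z need not lie in U: the intervals from p to z and from z to q are inside the one from p
    -- to q, hence in W.
    exact ⟨hAP p z hz.1 fun r hr ↦ hint p hp q hq ⟨hr.1, hr.2.trans hzq⟩,
      hAM q z hz.2 fun r hr ↦ hint p hp q hq ⟨hpz.trans hr.1, hr.2⟩⟩
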